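/- Let $0<p<1$, $q:=1-p$, and let $\mathsf{BS}(p)$ be the standardized Bernoulli distribution, i.e. the distribution of a random variable taking the value $\sqrt{q/p}$ with probability $p$ and the value $-\sqrt{p/q}$ with probability $q$. Put $$m_*(p):=\frac{1+p+2p^2}{2\left(\sqrt{p-p^2}+2p^2\right)}\ \text{ if } 0<p\le\tfrac12,\qquad m_*(p):=1\ \text{ if } \tfrac12\le p<1 .$$ Let $\mathcal F^3$ be the class of all twice continuously differentiable functions $f\colon\mathbb R\to\mathbb R$ such that $f$ and $f''$ are nondecreasing and convex. Let $n\ge1$, let $(S_0,S_1,\dots)$ be a supermartingale relative to a nondecreasing sequence of $\sigma$-algebras $(H_{\le0},H_{\le1},\dots)$, with $S_0\le0$ a.s. and differences $X_i:=S_i-S_{i-1}$. Suppose that for every $i\in\{1,\dots,n\}$ there are $H_{\le i-1}$-measurable random variables $A_{i-1}>0$ and $B_{i-1}>0$ and a non-random real number $c_i$ such that, almost surely, $$-A_{i-1}\le X_i\le B_{i-1},\qquad \sqrt{A_{i-1}B_{i-1}}\le c_i,\qquad \frac{B_{i-1}}{A_{i-1}}\le\frac qp .$$ Let $\mathrm{BS}_1,\dots,\mathrm{BS}_n$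 be independent random variables, each with the distribution $\mathsf{BS}(p)$. Then, for every real number $m\ge m_*(p)$ and every $f\in\mathcal F^3$, both expectations below are finite and $$\mathsf E f(S_n)\le\mathsf E f\bigl(s^{(m)}\cdot(\mathrm{BS}_1+\dots+\mathrm{BS}_n)\bigr),\qquad\text{where}\quad s^{(m)}:=\Bigl(\frac1n\sum_{i=1}^n c_i^{2m}\Bigr)^{1/(2m)} .$$ Moreover, the lower bound $m_*(p)$ on $m$ is exact for each $p\in(0,1)$: for every real $m$ with $0<m<m_*(p)$ there are $n\ge1$, a supermartingale $(S_i)$ with $A_{i-1},B_{i-1},c_i$ as above, and a function $f\in\mathcal F^3$ for which both expectations are finite and the inequality fails. -/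

import Mathlib

open MeasureTheory ProbabilityTheory

/-- The standardized Bernoulli distribution `BS(p)`: mass `p` at `√(q/p)` and mass `q` at
`-√(p/q)`, where `q = 1 - p`. -/
noncomputable def stdBernoulli (p : ℝ) : Measure ℝ :=
  ENNReal.ofReal p • Measure.dirac (Real.sqrt ((1 - p) / p)) +
    ENNReal.ofReal (1 - p) • Measure.dirac (-Real.sqrt (p / (1 - p)))

/-- The random variables `BS i` are independent, each with the distribution `BS(p)`. -/
structure IsIIDStdBernoulli {Ω : Type*} [MeasurableSpace Ω] (P : Measure Ω) (p : ℝ) {n : ℕ}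
    (BS : Fin n → Ω → ℝ) : Prop where
  law : ∀ i, HasLaw (BS i) (stdBernoulli p) P
  indep : iIndepFun BS P

/-- The class of `C²` functions `f : ℝ → ℝ` such that `f` and `f''` are nondecreasing and
convex. -/
def classF3 : Set (ℝ → ℝ) :=
  {f | ContDiff ℝ 2 f ∧ Monotone f ∧ ConvexOn ℝ Set.univ f ∧
    Monotone (iteratedDeriv 2 f) ∧ ConvexOn ℝ Set.univ (iteratedDeriv 2 f)}

/-- The threshold `m_*(p)`. -/
noncomputable def mStar (p : ℝ) : ℝ :=
  if p ≤ 1 / 2 then (1 + p + 2 * p ^ 2) / (2 * (Real.sqrt (p - p ^ 2) + 2 * p ^ 2)) else 1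

/-- The power mean `s^{(m)} = ((1/n) ∑ cᵢ^{2m})^{1/(2m)}`. -/
noncomputable def powerMean (m : ℝ) {n : ℕ} (c : Fin n → ℝ) : ℝ :=
  ((1 / (n : ℝ)) * ∑ i, c i ^ (2 * m)) ^ (1 / (2 * m))

/-- `(S_i)` is a supermartingale with `S_0 ≤ 0` a.s. whose first `n` differences have bounded
asymmetry. The index `i : Fin n` stands for the `(i+1)`-st step: its difference
`S_{i+1} - S_i` lies between `-A_i` and `B_i`, which are known at time `i`, and `c i` is the
constant belonging to that step. -/
structure IsBoundedAsymmetrySupermartingale {Ω : Type*} {mΩ : MeasurableSpace Ω}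
    (μ : Measure Ω) (ℱ : Filtration ℕ mΩ) (p : ℝ) (n : ℕ) (S A B : ℕ → Ω → ℝ)
    (c : Fin n → ℝ) : Prop where
  supermartingale : Supermartingale S ℱ μ
  init_nonpos : ∀ᵐ ω ∂μ, S 0 ω ≤ 0
  measurable_A : ∀ i : Fin n, Measurable[ℱ (i : ℕ)] (A i)
  measurable_B : ∀ i : Fin n, Measurable[ℱ (i : ℕ)] (B i)
  pos_A : ∀ i : Fin n, ∀ᵐ ω ∂μ, 0 < A i ω
  pos_B : ∀ i : Fin n, ∀ᵐ ω ∂μ, 0 < B i ω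
  neg_A_le_diff : ∀ i : Fin n, ∀ᵐ ω ∂μ, -A i ω ≤ S ((i : ℕ) + 1) ω - S i ω
  diff_le_B : ∀ i : Fin n, ∀ᵐ ω ∂μ, S ((i : ℕ) + 1) ω - S i ω ≤ B i ω
  sqrt_mul_le : ∀ i : Fin n, ∀ᵐ ω ∂μ, Real.sqrt (A i ω * B i ω) ≤ c i
  div_le : ∀ i : Fin n, ∀ᵐ ω ∂μ, B i ω / A i ω ≤ (1 - p) / p

/-! Write `q = 1 - p`. The proof reduces the supermartingale to independent two-point steps,
equalizes their scales, and tests the threshold locally.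

Reduction. Given the past, convexity bounds `f` on `[-A, B]` by a chord. Its slope is nonnegative,
so the supermartingale drift only helps, and the centred law on `{-A, B}` remains. A parabola
tangent to `f` at the lower atom of the scaled `BS(p)` law and meeting it at the upper atom
dominates `f` to the left of the latter, because `f''` is nondecreasing. Under centred laws a
parabola sees only the variance, here `A * B ≤ c ^ 2`, so the scaled Bernoulli law wins
(`IsF3.two_point_le`). Averaging preserves the class, so the steps can be exchanged one by one.

Equalization. In terms of the `2m`-th powers of the scales, the power mean is an arithmetic mean,
and it suffices to move two powers towards each other (`IsF3.monotoneOn_pair`). Differentiation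
leaves an inequality for `f'` with the factor `(a / b) ^ (2 * m - 1)`, where `a ≤ b` are the scales
(`IsF3.deriv_comparison`). Convexity of `f''` reduces it to constants and truncated linear functions
`(x - T)₊` in the role of `f''`, hence to a quadratic inequality in the position of `T`. For `p <
1/2`, with `g = √(q/p)`, the zero-discriminant curve of this quadratic is rational; it lies above
the graph of `a ^ κ`, `κ = (g ^ 2 + 1) / (g + 1)`, and touches it at `(1, 1)`. This `κ` is `2 *
mStar p - 1`. For `p ≥ 1/2`, `m ≥ 1` suffices.

Exactness. Spread two equal scales to `e^(-δ)` and `e^δ`. For `m < mStar p` a suitable truncated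
cube detects, to first order in `cosh δ - 1`, that the spread pair has the larger average. -/

/-! ### The zero-discriminant curve and the power function below it. -/

/-- Abscissa of the envelope curve. -/
noncomputable def envAbs (g s : ℝ) : ℝ :=
  (1 + g ^ 2) * s * (g * (g + 1) - (g - 1) * s) /
    ((g + 1 + g * (g - 1) * s) * ((g + 1) ^ 2 - 2 * g * s))

/-- Ordinate of the envelope curve. -/
noncomputable def envOrd (g s : ℝ) : ℝ :=
  s * (2 * g + (g - 1) ^ 2 * s) / ((g + 1) ^ 2 - 2 * g * s)

section
variable {g s : ℝ}

lemma env_d1_pos (hg : 1 < g) (hs1 : s ≤ 1) : 0 < (g + 1) ^ 2 - 2 * g * s := by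
  nlinarith [mul_nonneg (by linarith : (0:ℝ) ≤ g) (sub_nonneg.2 hs1), sq_nonneg g]

lemma env_d2_pos (hg : 1 < g) (hs1 : s ≤ 1) : 0 < g * (g + 1) - (g - 1) * s := by
  nlinarith [mul_nonneg (by linarith : (0:ℝ) ≤ g - 1) (sub_nonneg.2 hs1), sq_nonneg g]

lemma env_d3_pos (hg : 1 < g) (hs0 : 0 ≤ s) : 0 < g + 1 + g * (g - 1) * s := by
  have : 0 ≤ g * (g - 1) * s := mul_nonneg (mul_nonneg (by linarith) (by linarith)) hs0
  linarith

lemma env_d4_pos (hg : 1 < g) (hs0 : 0 ≤ s) : 0 < 2 * g + (g - 1) ^ 2 * s := by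
  have : 0 ≤ (g - 1) ^ 2 * s := mul_nonneg (sq_nonneg _) hs0
  linarith

lemma envAbs_one (hg : 1 < g) : envAbs g 1 = 1 := by
  have h : (1 + g ^ 2) ≠ 0 := by positivity
  rw [envAbs, div_eq_one_iff_eq]
  · ring
  · exact (mul_pos (env_d3_pos hg zero_le_one) (env_d1_pos hg le_rfl)).ne'

lemma envOrd_one (hg : 1 < g) : envOrd g 1 = 1 := by
  rw [envOrd, div_eq_one_iff_eq (env_d1_pos hg le_rfl).ne']
  ring

lemma envAbs_pos (hg : 1 < g) (hs0 : 0 < s) (hs1 : s ≤ 1) : 0 < envAbs g s := by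
  have := env_d1_pos hg hs1
  have := env_d2_pos hg hs1
  have := env_d3_pos hg hs0.le
  unfold envAbs
  positivity

lemma envOrd_pos (hg : 1 < g) (hs0 : 0 < s) (hs1 : s ≤ 1) : 0 < envOrd g s := by
  have := env_d1_pos hg hs1
  have := env_d4_pos hg hs0.le
  unfold envOrd
  positivity

lemma envOrd_le_one (hg : 1 < g) (hs0 : 0 ≤ s) (hs1 : s ≤ 1) : envOrd g s ≤ 1 := by
  rw [envOrd, div_le_one (env_d1_pos hg hs1)]
  nlinarith [mul_nonneg hs0 (sub_nonneg.2 hs1), mul_nonneg (mul_nonneg hs0 (sub_nonneg.2 hs1)) (sq_nonneg (g - 1)),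
    mul_nonneg (sub_nonneg.2 hs1) (sq_nonneg g)]

lemma exists_envAbs_eq (hg : 1 < g) {a : ℝ} (ha0 : 0 < a) (ha1 : a ≤ 1) :
    ∃ s, 0 < s ∧ s ≤ 1 ∧ envAbs g s = a := by
  have hc : ContinuousOn (envAbs g) (Set.Icc 0 1) := by
    unfold envAbs
    refine ContinuousOn.div (by fun_prop) (by fun_prop) fun x hx => ?_
    exact (mul_pos (env_d3_pos hg hx.1) (env_d1_pos hg hx.2)).ne'
  have h0 : envAbs g 0 = 0 := by simp [envAbs]
  obtain ⟨s, hs, hsa⟩ := intermediate_value_Icc zero_le_one hc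
    (show a ∈ Set.Icc (envAbs g 0) (envAbs g 1) by rw [h0, envAbs_one hg]; exact ⟨ha0.le, ha1⟩)
  refine ⟨s, lt_of_le_of_ne hs.1 ?_, hs.2, hsa⟩
  rintro rfl
  rw [h0] at hsa
  exact ha0.ne hsa

/-- Along the envelope curve the quadratic in `w` has zero discriminant. -/
lemma env_quadratic_nonneg (hg : 1 < g) (hs0 : 0 < s) (hs1 : s ≤ 1) (w : ℝ) :
    0 ≤ ((w + 1) ^ 2 - (w + 1 - envAbs g s) ^ 2) + g ^ 2 * w ^ 2
      - envOrd g s * (((w + 1) ^ 2 - w ^ 2) + g ^ 2 * (w + 1 - envAbs g s) ^ 2) := by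
  have h1 := env_d1_pos hg hs1
  have h3 := env_d3_pos hg hs0.le
  have hl := envOrd_le_one hg hs0.le hs1
  set a := envAbs g s with ha
  set l := envOrd g s with hl'
  have hdisc : (a - l - l * g ^ 2 * (1 - a)) ^ 2 =
      g ^ 2 * (1 - l) * (2 * a - a ^ 2 - l - l * g ^ 2 * (1 - a) ^ 2) := by
    have e1 : a * ((g + 1 + g * (g - 1) * s) * ((g + 1) ^ 2 - 2 * g * s)) =
        (1 + g ^ 2) * s * (g * (g + 1) - (g - 1) * s) := by
      rw [ha, envAbs, div_mul_cancel₀ _ (by positivity)]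
    have e2 : l * ((g + 1) ^ 2 - 2 * g * s) = s * (2 * g + (g - 1) ^ 2 * s) := by
      rw [hl', envOrd, div_mul_cancel₀ _ (by positivity)]
    have e3 : a = (1 + g ^ 2) * s * (g * (g + 1) - (g - 1) * s) /
        ((g + 1 + g * (g - 1) * s) * ((g + 1) ^ 2 - 2 * g * s)) := ha
    have e4 : l = s * (2 * g + (g - 1) ^ 2 * s) / ((g + 1) ^ 2 - 2 * g * s) := hl'
    clear_value a l
    generalize hd1 : (g + 1) ^ 2 - 2 * g * s = d1 at *
    generalize hd3 : g + 1 + g * (g - 1) * s = d3 at *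
    have n1 := h1.ne'
    have n3 := h3.ne'
    subst e3 e4
    clear e1 e2
    field_simp
    subst hd1 hd3
    ring
  -- The quadratic in `w` has leading coefficient `g ^ 2 * (1 - l)`. If this is positive, complete
  -- the square; if `l = 1`, the discriminant identity forces `a = 1` and the expression vanishes.
  rcases hl.lt_or_eq with h | h
  · have hpos : 0 < g ^ 2 * (1 - l) := by have : 0 < 1 - l := by linarith
                                          positivity
    refine nonneg_of_mul_nonneg_right ?_ hpos
    nlinarith [sq_nonneg (g ^ 2 * (1 - l) * w + (a - l - l * g ^ 2 * (1 - a)))]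
  · rw [h] at hdisc ⊢
    have : a = 1 := by
      have h0 : ((1 + g ^ 2) * (a - 1)) ^ 2 = 0 := by linear_combination hdisc
      have h0 := (mul_eq_zero.1 (pow_eq_zero_iff two_ne_zero |>.1 h0)).resolve_left (by positivity)
      linarith
    rw [this]; ring_nf; exact le_rfl

/-- Numerator of the derivative of `log envOrd - κ log envAbs`, up to sign and a positive factor.
With `g = 1 + h` it splits off `(1 - s) ^ 2`, and the cofactor has nonnegative coefficients in `h`,
`s` and `1 - s`. -/
lemma envOrd_deriv_numerator (hg : 1 < g) (hs0 : 0 < s) (hs1 : s ≤ 1) :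
    0 ≤ (g + 1) ^ 2 * g * (g * (g + 1) - (g - 1) * s) * (g + 1 + g * (g - 1) * s)
        * (2 * g + (g - 1) ^ 2 * s)
      - (g ^ 2 + 1) ^ 2 * (g + 1) * s * ((g + 1) ^ 2 - 2 * g * s) * (2 * g + (g - 1) ^ 2 * s)
      - (g ^ 2 - 1) * s * ((g + 1) ^ 2 - 2 * g * s) * (g * (g + 1) - (g - 1) * s)
        * (g + 1 + g * (g - 1) * s) := by
  obtain ⟨h, rfl⟩ : ∃ h, g = 1 + h := ⟨g - 1, by ring⟩
  have hh : 0 < h := by linarith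
  have key : 0 ≤ (1 - s) ^ 2 * ((32 + 160 * h + 336 * h ^ 2 + 384 * h ^ 3 + 258 * h ^ 4
      + 102 * h ^ 5 + 22 * h ^ 6 + 2 * h ^ 7)
      + s * (16 * h ^ 2 + 68 * h ^ 3 + 114 * h ^ 4 + 98 * h ^ 5 + 46 * h ^ 6 + 11 * h ^ 7 + h ^ 8)
      + s * (1 - s) * (4 * h ^ 3 + 10 * h ^ 4 + 8 * h ^ 5 + 2 * h ^ 6)) := by
    have : 0 ≤ 1 - s := by linarith
    positivity
  refine key.trans_eq ?_
  ring

/-- The function `F = log envOrd - κ log envAbs` is nonincreasing in `s` and vanishes at `s = 1`,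
where the curve passes through `(1, 1)`. -/
lemma envAbs_rpow_le_envOrd (hg : 1 < g) (hs0 : 0 < s) (hs1 : s ≤ 1) :
    envAbs g s ^ ((g ^ 2 + 1) / (g + 1)) ≤ envOrd g s := by
  set κ := (g ^ 2 + 1) / (g + 1) with hκ
  let F : ℝ → ℝ := fun s =>
    (Real.log s + Real.log (2 * g + (g - 1) ^ 2 * s) - Real.log ((g + 1) ^ 2 - 2 * g * s))
      - κ * (Real.log (1 + g ^ 2) + Real.log s + Real.log (g * (g + 1) - (g - 1) * s)
        - Real.log (g + 1 + g * (g - 1) * s) - Real.log ((g + 1) ^ 2 - 2 * g * s))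
  have hF : ∀ x, 0 < x → x ≤ 1 → F x = Real.log (envOrd g x) - κ * Real.log (envAbs g x) := by
    intro x h0 h1
    have e1 := (env_d1_pos hg h1).ne'
    have e2 := (env_d2_pos hg h1).ne'
    have e3 := (env_d3_pos hg h0.le).ne'
    have e4 := (env_d4_pos hg h0.le).ne'
    have e5 : (1 + g ^ 2) ≠ 0 := by positivity
    have e6 := h0.ne'
    simp only [F, envOrd, envAbs]
    rw [Real.log_div (by positivity) e1, Real.log_mul e6 e4, Real.log_div (by positivity) (by positivity),
      Real.log_mul (by positivity) e2, Real.log_mul e5 e6, Real.log_mul e3 e1]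
    ring
  have hd : ∀ x, 0 < x → x ≤ 1 → HasDerivAt F
      ((1 / x + (g - 1) ^ 2 / (2 * g + (g - 1) ^ 2 * x) - (-(2 * g)) / ((g + 1) ^ 2 - 2 * g * x))
      - κ * (1 / x + (-(g - 1)) / (g * (g + 1) - (g - 1) * x)
        - g * (g - 1) / (g + 1 + g * (g - 1) * x) - (-(2 * g)) / ((g + 1) ^ 2 - 2 * g * x))) x := by
    intro x h0 h1
    have hlin : ∀ α β : ℝ, HasDerivAt (fun y => α + β * y) β x := fun α β => by
      simpa using ((hasDerivAt_id x).const_mul β).const_add α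
    have hlin' : ∀ α β : ℝ, HasDerivAt (fun y => α - β * y) (-β) x := fun α β => by
      simpa using ((hasDerivAt_id x).const_mul β).const_sub α
    have l0 := (hasDerivAt_id x).log h0.ne'
    have l1 := (hlin' ((g + 1) ^ 2) (2 * g)).log (env_d1_pos hg h1).ne'
    have l2 := (hlin' (g * (g + 1)) (g - 1)).log (env_d2_pos hg h1).ne'
    have l3 := (hlin (g + 1) (g * (g - 1))).log (env_d3_pos hg h0.le).ne'
    have l4 := (hlin (2 * g) ((g - 1) ^ 2)).log (env_d4_pos hg h0.le).ne'
    exact ((l0.add l4).sub l1).sub ((((((l0.const_add _).add l2).sub l3).sub l1)).const_mul κ)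
  have hanti : AntitoneOn F (Set.Icc s 1) := by
    have hpos : ∀ x ∈ Set.Icc s 1, 0 < x := fun x hx => hs0.trans_le hx.1
    refine antitoneOn_of_deriv_nonpos (convex_Icc _ _)
      (fun x hx => (hd x (hpos x hx) hx.2).continuousAt.continuousWithinAt)
      (fun x hx => ?_) fun x hx => ?_
    · have hx := interior_subset hx
      exact (hd x (hpos x hx) hx.2).differentiableAt.differentiableWithinAt
    · have hx := interior_subset hx
      have h0 := hpos x hx
      rw [(hd x h0 hx.2).deriv]
      have e1 := env_d1_pos hg hx.2
      have e2 := env_d2_pos hg hx.2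
      have e3 := env_d3_pos hg h0.le
      have e4 := env_d4_pos hg h0.le
      have e5 : 0 < g + 1 := by linarith
      have hn := envOrd_deriv_numerator hg h0 hx.2
      have hg1 : 0 < g - 1 := by linarith
      have hD : 0 ≤ (g - 1) * ((g + 1) ^ 2 * g * (g * (g + 1) - (g - 1) * x)
          * (g + 1 + g * (g - 1) * x) * (2 * g + (g - 1) ^ 2 * x)
          - (g ^ 2 + 1) ^ 2 * (g + 1) * x * ((g + 1) ^ 2 - 2 * g * x) * (2 * g + (g - 1) ^ 2 * x)
          - (g ^ 2 - 1) * x * ((g + 1) ^ 2 - 2 * g * x) * (g * (g + 1) - (g - 1) * x)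
            * (g + 1 + g * (g - 1) * x)) / ((g + 1) * x * ((g + 1) ^ 2 - 2 * g * x)
          * (g * (g + 1) - (g - 1) * x) * (g + 1 + g * (g - 1) * x) * (2 * g + (g - 1) ^ 2 * x)) := by
        have := hg1.le
        positivity
      refine le_of_eq_of_le ?_ (neg_nonpos.2 hD)
      rw [hκ]
      clear hD hn hF hd
      generalize hd1 : (g + 1) ^ 2 - 2 * g * x = d1 at *
      generalize hd2 : g * (g + 1) - (g - 1) * x = d2 at *
      generalize hd3 : g + 1 + g * (g - 1) * x = d3 at *
      generalize hd4 : 2 * g + (g - 1) ^ 2 * x = d4 at *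
      have n1 := e1.ne'
      have n2 := e2.ne'
      have n3 := e3.ne'
      have n4 := e4.ne'
      field_simp
      subst hd1 hd2 hd3 hd4
      ring
  have h1 := hanti (Set.left_mem_Icc.2 hs1) (Set.right_mem_Icc.2 hs1) hs1
  rw [hF s hs0 hs1, hF 1 one_pos le_rfl, envOrd_one hg, envAbs_one hg] at h1
  simp only [Real.log_one, mul_zero, sub_zero] at h1
  rw [← Real.log_le_log_iff (Real.rpow_pos_of_pos (envAbs_pos hg hs0 hs1) _) (envOrd_pos hg hs0 hs1),
    Real.log_rpow (envAbs_pos hg hs0 hs1)]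
  linarith

end

/-! ### The threshold and the quadratic inequality. -/

lemma two_mul_mStar_sub_one {p : ℝ} (hp0 : 0 < p) (hp : p < 1 / 2) :
    2 * mStar p - 1 = (√((1 - p) / p) ^ 2 + 1) / (√((1 - p) / p) + 1) := by
  have hq : 0 < (1 - p) / p := div_pos (by linarith) hp0
  have hg := Real.sqrt_pos.2 hq
  have hr : √(p - p ^ 2) = p * √((1 - p) / p) := by
    rw [Real.sqrt_eq_iff_mul_self_eq (by nlinarith) (by positivity)]
    have := Real.mul_self_sqrt hq.le
    have h2 : p * √((1 - p) / p) * (p * √((1 - p) / p)) = p ^ 2 * ((1 - p) / p) := by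
      linear_combination p ^ 2 * this
    rw [h2]
    field_simp
  have hgp : √((1 - p) / p) ^ 2 * p = 1 - p := by
    rw [Real.sq_sqrt hq.le, div_mul_cancel₀ _ hp0.ne']
  rw [mStar, if_pos hp.le, hr]
  generalize √((1 - p) / p) = g at *
  have hp' : p = 1 / (1 + g ^ 2) := by
    rw [eq_div_iff (by positivity)]; linarith
  subst hp'
  field_simp
  ring

lemma mStar_of_half_le {p : ℝ} (hp : 1 / 2 ≤ p) : mStar p = 1 := by
  rcases hp.eq_or_lt with rfl | h
  · rw [mStar, if_pos le_rfl, show (1 / 2 - (1 / 2) ^ 2 : ℝ) = (1 / 2) ^ 2 by norm_num,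
      Real.sqrt_sq (by norm_num)]
    norm_num
  · rw [mStar, if_neg (not_le.2 h)]

lemma one_lt_sqrt_div {p : ℝ} (hp0 : 0 < p) (hp : p < 1 / 2) : 1 < √((1 - p) / p) := by
  rw [Real.lt_sqrt zero_le_one, one_pow, one_lt_div hp0]
  linarith

lemma one_le_mStar {p : ℝ} (hp0 : 0 < p) : 1 ≤ mStar p := by
  rcases lt_or_ge p (1 / 2) with hp | hp
  · have h := two_mul_mStar_sub_one hp0 hp
    have hg := one_lt_sqrt_div hp0 hp
    have : 1 ≤ (√((1 - p) / p) ^ 2 + 1) / (√((1 - p) / p) + 1) := by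
      rw [le_div_iff₀ (by linarith)]; nlinarith
    linarith
  · rw [mStar_of_half_le hp]

/-- The comparison of the two directional derivatives for a truncated linear function, with the
larger of the two scales equal to one. -/
lemma truncation_comparison_unit {p m a w : ℝ} (hp0 : 0 < p) (hp1 : p < 1) (hm : mStar p ≤ m)
    (ha : 0 < a) (ha1 : a ≤ 1) (hw : 0 ≤ w) :
    0 ≤ p * ((w + 1) ^ 2 - (w + 1 - a) ^ 2) + (1 - p) * w ^ 2
      - a ^ (2 * m - 1) * (p * ((w + 1) ^ 2 - w ^ 2) + (1 - p) * (w + 1 - a) ^ 2) := by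
  have hD : 0 ≤ p * ((w + 1) ^ 2 - w ^ 2) + (1 - p) * (w + 1 - a) ^ 2 := by
    have : 0 ≤ (w + 1) ^ 2 - w ^ 2 := by nlinarith
    have : 0 ≤ 1 - p := by linarith
    positivity
  rcases lt_or_ge p (1 / 2) with hp | hp
  · have hg := one_lt_sqrt_div hp0 hp
    have hκ := two_mul_mStar_sub_one hp0 hp
    have hgp : √((1 - p) / p) ^ 2 * p = 1 - p := by
      rw [Real.sq_sqrt (div_pos (by linarith) hp0).le, div_mul_cancel₀ _ hp0.ne']
    generalize √((1 - p) / p) = g at *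
    -- The expression is nonincreasing in the factor `a ^ (2 * m - 1)`, so this factor may be raised
    -- to the ordinate of the curve above `a`.
    obtain ⟨s, hs0, hs1, rfl⟩ := exists_envAbs_eq hg ha ha1
    have h1 : envAbs g s ^ (2 * m - 1) ≤ envOrd g s :=
      (Real.rpow_le_rpow_of_exponent_ge ha ha1 (by linarith)).trans
        (envAbs_rpow_le_envOrd hg hs0 hs1)
    have h2 := mul_nonneg hp0.le (env_quadratic_nonneg hg hs0 hs1 w)
    have h3 := mul_le_mul_of_nonneg_right h1 hD
    rw [← hgp] at h3 ⊢
    linarith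
  · rw [mStar_of_half_le hp] at hm
    have h1 : a ^ (2 * m - 1) ≤ a := by
      simpa using Real.rpow_le_rpow_of_exponent_ge ha ha1 (by linarith : (1:ℝ) ≤ 2 * m - 1)
    have h3 := mul_le_mul_of_nonneg_right h1 hD
    -- This product is the whole expression with `a ^ (2 * m - 1)` replaced by `a`.
    have h4 : 0 ≤ (1 - a) * ((1 - p) * (w - a) ^ 2 + a * (2 * p - 1)) :=
      mul_nonneg (by linarith) (add_nonneg (mul_nonneg (by linarith) (sq_nonneg _))
        (mul_nonneg ha.le (by linarith)))
    linarith

/-- Homogeneity reduces this to `b = 1`. For `w ≤ a` it is `IsF3.deriv_comparison` for `f'' = (x -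
T)₊` with `T = W + a - w`, multiplied by two. -/
lemma truncation_comparison {p m a b w : ℝ} (hp0 : 0 < p) (hp1 : p < 1) (hm : mStar p ≤ m)
    (ha : 0 < a) (hab : a ≤ b) (hw : 0 ≤ w) :
    0 ≤ p * ((w + b) ^ 2 - (w + b - a) ^ 2) + (1 - p) * w ^ 2
      - (a / b) ^ (2 * m - 1) * (p * ((w + b) ^ 2 - w ^ 2) + (1 - p) * (w + b - a) ^ 2) := by
  have hb : 0 < b := ha.trans_le hab
  have h := truncation_comparison_unit hp0 hp1 hm (div_pos ha hb) ((div_le_one hb).2 hab)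
    (div_nonneg hw hb.le)
  have := mul_nonneg (sq_nonneg b) h
  refine this.trans_eq ?_
  generalize (a / b) ^ (2 * m - 1) = l
  field_simp

/-! ### The function class and the comparison of directional derivatives. -/

/-- `f1` and `f2` are the first two derivatives of a nondecreasing convex function `f` whose
second derivative is nondecreasing, convex and continuous. -/
structure IsF3 (f f1 f2 : ℝ → ℝ) : Prop where
  hasDeriv : ∀ x, HasDerivAt f (f1 x) x
  hasDeriv' : ∀ x, HasDerivAt f1 (f2 x) x
  cont : Continuous f2
  nonneg1 : ∀ x, 0 ≤ f1 x
  nonneg2 : ∀ x, 0 ≤ f2 x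
  mono2 : Monotone f2
  convex2 : ConvexOn ℝ Set.univ f2

lemma exists_isF3_of_mem_classF3 {f : ℝ → ℝ} (hf : f ∈ classF3) : ∃ f1 f2, IsF3 f f1 f2 := by
  obtain ⟨h1, h2, h3, h4, h5⟩ := hf
  have hd : Differentiable ℝ f := h1.differentiable (by norm_num)
  have h1' : ContDiff ℝ 1 (deriv f) := by
    have : ContDiff ℝ (1 + 1) f := by convert h1 using 1; norm_num
    exact (contDiff_succ_iff_deriv.1 this).2.2
  have hd' : Differentiable ℝ (deriv f) := h1'.differentiable (by norm_num)
  have e : iteratedDeriv 2 f = deriv (deriv f) := by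
    rw [iteratedDeriv_succ, iteratedDeriv_one]
  rw [e] at h4 h5
  refine ⟨deriv f, deriv (deriv f), fun x => (hd x).hasDerivAt, fun x => (hd' x).hasDerivAt,
    h1'.continuous_deriv (by norm_num), fun x => h2.deriv_nonneg, fun x => ?_, h4, h5⟩
  have : Monotone (deriv f) := fun x y hxy =>
    h3.monotoneOn_deriv (fun x _ => hd x) (Set.mem_univ x) (Set.mem_univ y) hxy
  exact this.deriv_nonneg

lemma sub_ge_of_affine_le_deriv {h g : ℝ → ℝ} (hh : ∀ x, HasDerivAt h (g x) x) {α β x y : ℝ}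
    (hxy : x ≤ y) (hle : ∀ z ∈ Set.Icc x y, α + β * z ≤ g z) :
    (y - x) * ((α + β * x) + (α + β * y)) / 2 ≤ h y - h x := by
  have hd : ∀ z, HasDerivAt (fun z => h z - (α * z + β * z ^ 2 / 2)) (g z - (α + β * z)) z := by
    intro z
    have h1 : HasDerivAt (fun z => α * z + β * z ^ 2 / 2) (α + β * z) z := by
      have := ((hasDerivAt_id z).const_mul α).add
        ((((hasDerivAt_id z).pow 2).const_mul β).div_const 2)
      refine HasDerivAt.congr_deriv this ?_
      simp only [id_eq, mul_one, Nat.cast_ofNat, Nat.add_one_sub_one, pow_one]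
      ring
    exact (hh z).sub h1
  have hm : MonotoneOn (fun z => h z - (α * z + β * z ^ 2 / 2)) (Set.Icc x y) := by
    refine monotoneOn_of_deriv_nonneg (convex_Icc _ _)
      (fun z _ => (hd z).continuousAt.continuousWithinAt)
      (fun z _ => (hd z).differentiableAt.differentiableWithinAt) fun z hz => ?_
    rw [(hd z).deriv]
    linarith [hle z (interior_subset hz)]
  have := hm (Set.left_mem_Icc.2 hxy) (Set.right_mem_Icc.2 hxy) hxy
  simp only at this
  linarith

lemma sub_le_of_deriv_le_affine {h g : ℝ → ℝ} (hh : ∀ x, HasDerivAt h (g x) x) {α β x y : ℝ}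
    (hxy : x ≤ y) (hle : ∀ z ∈ Set.Icc x y, g z ≤ α + β * z) :
    h y - h x ≤ (y - x) * ((α + β * x) + (α + β * y)) / 2 := by
  have := sub_ge_of_affine_le_deriv (h := fun x => - h x) (g := fun x => - g x)
    (α := -α) (β := -β) (fun x => (hh x).neg) hxy (fun z hz => by linarith [hle z hz])
  linarith

/-- The chord of a convex function lies above it between the end points and below it outside. -/
lemma ConvexOn.chord_bounds {g : ℝ → ℝ} (hg : ConvexOn ℝ Set.univ g) {V U : ℝ} (hVU : V < U) :
    (∀ z ∈ Set.Icc V U, g z ≤ g V + (g U - g V) / (U - V) * (z - V)) ∧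
    (∀ z ≤ V, g V + (g U - g V) / (U - V) * (z - V) ≤ g z) ∧
    (∀ z, U ≤ z → g V + (g U - g V) / (U - V) * (z - V) ≤ g z) := by
  have hUV : 0 < U - V := sub_pos.2 hVU
  refine ⟨fun z hz => ?_, fun z hz => ?_, fun z hz => ?_⟩
  · rcases hz.1.eq_or_lt with rfl | h1
    · simp
    rcases hz.2.eq_or_lt with rfl | h2
    · rw [div_mul_cancel₀ _ hUV.ne']; linarith
    have := hg.secant_mono_aux2 (Set.mem_univ V) (Set.mem_univ U) h1 h2
    rw [div_le_iff₀ (by linarith)] at this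
    linarith
  · rcases hz.eq_or_lt with rfl | h1
    · simp
    have := hg.slope_mono_adjacent (Set.mem_univ z) (Set.mem_univ U) h1 hVU
    rw [div_le_iff₀ (by linarith)] at this
    linarith
  · rcases hz.eq_or_lt with rfl | h1
    · rw [div_mul_cancel₀ _ hUV.ne']; linarith
    have := hg.secant_mono_aux2 (Set.mem_univ V) (Set.mem_univ z) hVU h1
    rw [le_div_iff₀ (by linarith)] at this
    linarith

/-- The comparison of the directional derivatives of the two-point averages. -/
lemma IsF3.deriv_comparison {f h g : ℝ → ℝ} (hf : IsF3 f h g) {p m a b W : ℝ} (hp0 : 0 < p)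
    (hp1 : p < 1) (hm : mStar p ≤ m) (ha : 0 < a) (hab : a ≤ b) :
    (a / b) ^ (2 * m - 1) * (p * (h (W + a + b) - h (W + a)) + (1 - p) * (h (W + b) - h W)) ≤
      p * (h (W + a + b) - h (W + b)) + (1 - p) * (h (W + a) - h W) := by
  have hb : 0 < b := ha.trans_le hab
  rcases hab.eq_or_lt with rfl | hlt
  · simp [div_self ha.ne']
  have hm1 : 1 ≤ m := (one_le_mStar hp0).trans hm
  have hab1 : a / b ≤ 1 := (div_le_one hb).2 hab
  have hl0 : 0 ≤ (a / b) ^ (2 * m - 1) := Real.rpow_nonneg (div_pos ha hb).le _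
  have hl1 : (a / b) ^ (2 * m - 1) ≤ a / b := by
    simpa using Real.rpow_le_rpow_of_exponent_ge (div_pos ha hb) hab1
      (by linarith : (1:ℝ) ≤ 2 * m - 1)
  have key := fun w hw => truncation_comparison (w := w) hp0 hp1 hm ha hab hw
  have hlb : (a / b) ^ (2 * m - 1) * b ≤ a := by
    rwa [le_div_iff₀ hb] at hl1
  generalize (a / b) ^ (2 * m - 1) = l at *
  have hl1' : l ≤ 1 := hl1.trans hab1
  -- With the factor `l`, the difference of the two sides weighs the increments of `h` over `[W, W +
  -- a]` and `[W + b, W + a + b]` positively and that over `[W + a, W + b]` negatively. The chord of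
  -- `g` through `W + a` and `W + b` errs in the right direction on all three.
  obtain ⟨c1, c2, c3⟩ := hf.convex2.chord_bounds (show W + a < W + b by linarith)
  have hσ0 : 0 ≤ (g (W + b) - g (W + a)) / (W + b - (W + a)) :=
    div_nonneg (sub_nonneg.2 (hf.mono2 (by linarith))) (by linarith)
  generalize (g (W + b) - g (W + a)) / (W + b - (W + a)) = σ at *
  have hG0 := hf.nonneg2 (W + a)
  generalize g (W + a) = G at *
  have i1 := sub_ge_of_affine_le_deriv hf.hasDeriv' (x := W + b) (y := W + a + b)
    (α := G - σ * (W + a)) (β := σ) (by linarith) (fun z hz => by linarith [c3 z hz.1])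
  have i2 := sub_le_of_deriv_le_affine hf.hasDeriv' (x := W + a) (y := W + b)
    (α := G - σ * (W + a)) (β := σ) (by linarith) (fun z hz => by linarith [c1 z hz])
  have i3 : ∀ t ∈ Set.Icc 0 a, t * (2 * G - σ * t) / 2 ≤ h (W + a) - h W := by
    intro t ht
    have := sub_ge_of_affine_le_deriv hf.hasDeriv' (x := W + a - t) (y := W + a)
      (α := G - σ * (W + a)) (β := σ) (by linarith [ht.1]) (fun z hz => by linarith [c2 z hz.2])
    have h2 : h W ≤ h (W + a - t) :=
      (monotone_of_deriv_nonneg (fun z => (hf.hasDeriv' z).differentiableAt)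
        fun z => by rw [(hf.hasDeriv' z).deriv]; exact hf.nonneg2 z) (by linarith [ht.2])
    linarith
  suffices hs : ∃ I, I ≤ h (W + a) - h W ∧
      0 ≤ (1 - l) * p * (a * (2 * G + σ * (2 * b - a)) / 2) + (1 - l) * (1 - p) * I
        - l * ((b - a) * (2 * G + σ * (b - a)) / 2) by
    obtain ⟨I, hI, h0⟩ := hs
    have j1 := mul_le_mul_of_nonneg_left i1 (mul_nonneg (sub_nonneg.2 hl1') hp0.le)
    have j2 := mul_le_mul_of_nonneg_left i2 hl0
    have j3 := mul_le_mul_of_nonneg_left hI (mul_nonneg (sub_nonneg.2 hl1') (sub_nonneg.2 hp1.le))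
    linarith
  -- If the chord is nonnegative at `W`, it is a constant `G - σ * a` plus the ramp with `w = a`;
  -- the constant needs only `l * b ≤ a`. Otherwise it is cut off at its zero `W + a - t`, which
  -- gives the ramp with `w = t`.
  by_cases hc : σ * a ≤ G
  · refine ⟨_, i3 a ⟨ha.le, le_rfl⟩, ?_⟩
    have k1 := mul_nonneg (sub_nonneg.2 hc) (sub_nonneg.2 hlb)
    have k2 := mul_nonneg hσ0 (key a ha.le)
    linarith
  · push Not at hc
    have hσ : 0 < σ := by
      rcases hσ0.eq_or_lt with h | h
      · rw [← h] at hc; linarith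
      · exact h
    obtain ⟨t, rfl⟩ : ∃ t, G = σ * t := ⟨G / σ, by field_simp⟩
    have ht0 : 0 ≤ t := nonneg_of_mul_nonneg_right hG0 hσ
    have hta : t ≤ a := (lt_of_mul_lt_mul_left hc hσ.le).le
    refine ⟨_, i3 t ⟨ht0, hta⟩, ?_⟩
    have k2 := mul_nonneg hσ0 (key t ht0)
    linarith

/-! ### Two-point averages. -/

/-- The average of `f` over the centred two-point distribution with mass `p` at `x + (1 - p) * u`
and mass `1 - p` at `x - p * u`. -/
def twoPointAvg (p u : ℝ) (f : ℝ → ℝ) (x : ℝ) : ℝ :=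
  p * f (x + (1 - p) * u) + (1 - p) * f (x - p * u)

lemma twoPointAvg_comm (p u v : ℝ) (f : ℝ → ℝ) :
    twoPointAvg p u (twoPointAvg p v f) = twoPointAvg p v (twoPointAvg p u f) := by
  funext x
  simp only [twoPointAvg, add_sub_right_comm, sub_right_comm x, add_right_comm x]
  ring

lemma twoPointAvg_mono {p : ℝ} (hp0 : 0 < p) (hp1 : p < 1) (u : ℝ) {f f' : ℝ → ℝ} (h : f ≤ f') :
    twoPointAvg p u f ≤ twoPointAvg p u f' := fun x =>
  add_le_add (mul_le_mul_of_nonneg_left (h _) hp0.le)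
    (mul_le_mul_of_nonneg_left (h _) (by linarith))

lemma hasDerivAt_twoPointAvg {p u x : ℝ} {f f1 : ℝ → ℝ} (h : ∀ x, HasDerivAt f (f1 x) x) :
    HasDerivAt (twoPointAvg p u f) (twoPointAvg p u f1 x) x :=
  (((h _).comp_add_const x _).const_mul p).add (((h _).comp_sub_const x _).const_mul (1 - p))

lemma continuous_twoPointAvg {p u : ℝ} {f : ℝ → ℝ} (h : Continuous f) :
    Continuous (twoPointAvg p u f) := by
  unfold twoPointAvg
  fun_prop

lemma IsF3.avg {f f1 f2 : ℝ → ℝ} (hf : IsF3 f f1 f2) {p : ℝ} (hp0 : 0 < p) (hp1 : p < 1)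
    (u : ℝ) : IsF3 (twoPointAvg p u f) (twoPointAvg p u f1) (twoPointAvg p u f2) where
  hasDeriv x := hasDerivAt_twoPointAvg hf.hasDeriv
  hasDeriv' x := hasDerivAt_twoPointAvg hf.hasDeriv'
  cont := continuous_twoPointAvg hf.cont
  nonneg1 x := add_nonneg (mul_nonneg hp0.le (hf.nonneg1 _))
    (mul_nonneg (by linarith) (hf.nonneg1 _))
  nonneg2 x := add_nonneg (mul_nonneg hp0.le (hf.nonneg2 _))
    (mul_nonneg (by linarith) (hf.nonneg2 _))
  mono2 x y h := add_le_add (mul_le_mul_of_nonneg_left (hf.mono2 (by linarith)) hp0.le)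
    (mul_le_mul_of_nonneg_left (hf.mono2 (by linarith)) (by linarith))
  convex2 := by
    have h1 : ConvexOn ℝ Set.univ fun x => f2 (x + (1 - p) * u) := by
      simpa [Function.comp_def] using! hf.convex2.translate_left ((1 - p) * u)
    have h2 : ConvexOn ℝ Set.univ fun x => f2 (x - p * u) := by
      simpa [Function.comp_def, sub_eq_add_neg] using! hf.convex2.translate_left (-(p * u))
    exact (h1.smul hp0.le).add (h2.smul (by linarith : 0 ≤ 1 - p))

/-! ### Extremality of the Bernoulli law among centred two-point laws. -/

section OneStep
variable {f f1 f2 : ℝ → ℝ}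

lemma IsF3.continuous (hf : IsF3 f f1 f2) : Continuous f :=
  continuous_iff_continuousAt.2 fun x => (hf.hasDeriv x).continuousAt

lemma IsF3.mono (hf : IsF3 f f1 f2) : Monotone f :=
  monotone_of_deriv_nonneg (fun z => (hf.hasDeriv z).differentiableAt)
    fun z => by rw [(hf.hasDeriv z).deriv]; exact hf.nonneg1 z

lemma IsF3.mono1 (hf : IsF3 f f1 f2) : Monotone f1 :=
  monotone_of_deriv_nonneg (fun z => (hf.hasDeriv' z).differentiableAt)
    fun z => by rw [(hf.hasDeriv' z).deriv]; exact hf.nonneg2 z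

lemma IsF3.convex (hf : IsF3 f f1 f2) : ConvexOn ℝ Set.univ f := by
  have hd : deriv f = f1 := funext fun x => (hf.hasDeriv x).deriv
  refine Monotone.convexOn_univ_of_deriv (fun x => (hf.hasDeriv x).differentiableAt) ?_
  rw [hd]
  exact hf.mono1

lemma IsF3.taylor (hf : IsF3 f f1 f2) (z d : ℝ) :
    f (z + d) = f z + f1 z * d + d ^ 2 * ∫ s in (0:ℝ)..1, (1 - s) * f2 (z + s * d) := by
  have hc := hf.cont
  have hd : ∀ s ∈ Set.uIcc (0:ℝ) 1, HasDerivAt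
      (fun s => f (z + s * d) + (1 - s) * d * f1 (z + s * d))
      (d ^ 2 * ((1 - s) * f2 (z + s * d))) s := by
    intro s _
    have h0 : HasDerivAt (fun s : ℝ => z + s * d) d s := by
      simpa using ((hasDerivAt_id s).mul_const d).const_add z
    have h1 : HasDerivAt (fun s : ℝ => (1 - s) * d) (-d) s := by
      simpa using ((hasDerivAt_id s).const_sub 1).mul_const d
    have h2 := ((hf.hasDeriv (z + s * d)).comp s h0)
    have h3 := ((hf.hasDeriv' (z + s * d)).comp s h0)
    refine (h2.add (h1.mul h3)).congr_deriv ?_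
    simp only [Function.comp_apply]
    ring
  have := intervalIntegral.integral_eq_sub_of_hasDerivAt hd
    (Continuous.intervalIntegrable (by fun_prop) 0 1)
  rw [intervalIntegral.integral_const_mul] at this
  simp only [one_mul, sub_self, zero_mul, add_zero, sub_zero] at this
  rw [this]
  ring

/-- The parabola tangent to `f` at `z` and meeting it at `b` dominates `f` to the left of `b`. -/
lemma IsF3.exists_dominating_parabola (hf : IsF3 f f1 f2) (z b : ℝ) :
    ∃ P2, 0 ≤ P2 ∧ f b = f z + f1 z * (b - z) + P2 * (b - z) ^ 2 ∧
      ∀ y ≤ b, f y ≤ f z + f1 z * (y - z) + P2 * (y - z) ^ 2 := by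
  have hc := hf.cont
  have hint : ∀ d, IntervalIntegrable (fun s : ℝ => (1 - s) * f2 (z + s * d)) volume 0 1 :=
    fun d => Continuous.intervalIntegrable (by fun_prop) 0 1
  have ht := fun y => hf.taylor z (y - z)
  simp only [add_sub_cancel] at ht
  -- The quadratic Taylor remainder coefficient at `b`; it is nondecreasing in the end point because
  -- `f2` is.
  refine ⟨∫ s in (0:ℝ)..1, (1 - s) * f2 (z + s * (b - z)), ?_, ?_, fun y hy => ?_⟩
  · refine intervalIntegral.integral_nonneg zero_le_one fun s hs => ?_
    exact mul_nonneg (by linarith [hs.2]) (hf.nonneg2 _)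
  · rw [ht b]; ring
  · rw [ht y]
    have : ∫ s in (0:ℝ)..1, (1 - s) * f2 (z + s * (y - z)) ≤
        ∫ s in (0:ℝ)..1, (1 - s) * f2 (z + s * (b - z)) := by
      refine intervalIntegral.integral_mono_on zero_le_one (hint _) (hint _) fun s hs => ?_
      refine mul_le_mul_of_nonneg_left (hf.mono2 ?_) (by linarith [hs.2])
      have := mul_le_mul_of_nonneg_left (sub_le_sub_right hy z) hs.1
      linarith
    have := mul_le_mul_of_nonneg_left this (sq_nonneg (y - z))
    linarith

/-- `B ^ 2 = (B / A) * (A * B)`, and both factors are bounded. -/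
lemma upper_le_of_asymmetry {p u A B : ℝ} (hp0 : 0 < p) (hp1 : p < 1) (hu : 0 ≤ u) (hA : 0 < A)
    (hB : 0 < B) (hAB : A * B ≤ p * (1 - p) * u ^ 2) (hBA : B / A ≤ (1 - p) / p) :
    B ≤ (1 - p) * u := by
  have hq : 0 < 1 - p := by linarith
  rw [div_le_div_iff₀ hA hp0] at hBA
  refine le_of_sq_le_sq ?_ (by positivity)
  have h1 := mul_le_mul_of_nonneg_left hBA hB.le
  have h2 := mul_le_mul_of_nonneg_left hAB hq.le
  refine le_of_mul_le_mul_left (a := p) ?_ hp0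
  nlinarith

/-- Comparison of centred two-point distributions. -/
lemma IsF3.two_point_le (hf : IsF3 f f1 f2) {p u A B : ℝ} (hp0 : 0 < p) (hp1 : p < 1) (hu : 0 ≤ u) (hA : 0 < A)
    (hB : 0 < B) (hAB : A * B ≤ p * (1 - p) * u ^ 2) (hBA : B / A ≤ (1 - p) / p) (x : ℝ) :
    (B * f (x - A) + A * f (x + B)) / (A + B) ≤ twoPointAvg p u f x := by
  have hq : 0 < 1 - p := by linarith
  have hBb := upper_le_of_asymmetry hp0 hp1 hu hA hB hAB hBA
  -- Both points `x - A` and `x + B` lie to the left of the meeting point. The averages of the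
  -- parabola under the two centred laws differ by `c * (A * B - p * (1 - p) * u ^ 2) ≤ 0`.
  obtain ⟨c, hc0, hcb, hc⟩ := hf.exists_dominating_parabola (x - p * u) (x + (1 - p) * u)
  have k1 := hc (x - A) (by nlinarith)
  have k2 := hc (x + B) (by linarith)
  rw [twoPointAvg, hcb, div_le_iff₀ (by linarith)]
  have j1 := mul_le_mul_of_nonneg_left k1 hB.le
  have j2 := mul_le_mul_of_nonneg_left k2 hA.le
  have j3 := mul_le_mul_of_nonneg_left hAB (mul_nonneg hc0 (add_pos hA hB).le)
  linarith

lemma IsF3.twoPointAvg_mono_scale (hf : IsF3 f f1 f2) {p u v : ℝ} (hp0 : 0 < p) (hp1 : p < 1) (hu : 0 < u)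
    (huv : u ≤ v) (x : ℝ) : twoPointAvg p u f x ≤ twoPointAvg p v f x := by
  have hq : 0 < 1 - p := by linarith
  have h := hf.two_point_le hp0 hp1 (hu.le.trans huv) (mul_pos hp0 hu) (mul_pos hq hu)
    (by have := mul_le_mul_of_nonneg_left (pow_le_pow_left₀ hu.le huv 2) (mul_pos hp0 hq).le
        linarith) (by rw [mul_div_mul_right _ _ hu.ne']) x
  refine le_trans (le_of_eq ?_) h
  rw [twoPointAvg, ← add_mul, add_sub_cancel, one_mul, eq_div_iff hu.ne']
  ring

end OneStep

/-! ### Equalizing the scales. -/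

/-- Moving the `2m`-th powers of two scales towards each other increases the average. -/
lemma IsF3.monotoneOn_pair {f f1 f2 : ℝ → ℝ} (hf : IsF3 f f1 f2) {p m c : ℝ} (hp0 : 0 < p)
    (hp1 : p < 1) (hm : mStar p ≤ m) (x : ℝ) :
    MonotoneOn (fun U => twoPointAvg p (U ^ (1 / (2 * m)))
      (twoPointAvg p ((c - U) ^ (1 / (2 * m))) f) x) (Set.Ioc 0 (c / 2)) := by
  have hm0 : 0 < m := zero_lt_one.trans_le ((one_le_mStar hp0).trans hm)
  have hq : 0 < 1 - p := by linarith
  have hθ : 0 < 1 / (2 * m) := by positivity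
  have hθm : 1 / (2 * m) * (2 * m - 1) = 1 - 1 / (2 * m) := by field_simp
  set θ := 1 / (2 * m)
  have hd : ∀ U ∈ Set.Ioc 0 (c / 2), HasDerivAt (fun U => twoPointAvg p (U ^ θ)
      (twoPointAvg p ((c - U) ^ θ) f) x)
      (θ * p * (1 - p) * (U ^ (θ - 1) *
        (p * (f1 (x - p * (U ^ θ + (c - U) ^ θ) + U ^ θ + (c - U) ^ θ)
            - f1 (x - p * (U ^ θ + (c - U) ^ θ) + (c - U) ^ θ))
          + (1 - p) * (f1 (x - p * (U ^ θ + (c - U) ^ θ) + U ^ θ)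
            - f1 (x - p * (U ^ θ + (c - U) ^ θ))))
        - (c - U) ^ (θ - 1) *
        (p * (f1 (x - p * (U ^ θ + (c - U) ^ θ) + U ^ θ + (c - U) ^ θ)
            - f1 (x - p * (U ^ θ + (c - U) ^ θ) + U ^ θ))
          + (1 - p) * (f1 (x - p * (U ^ θ + (c - U) ^ θ) + (c - U) ^ θ)
            - f1 (x - p * (U ^ θ + (c - U) ^ θ)))))) U := by
    intro U hU
    have hcU : 0 < c - U := by linarith [hU.1, hU.2]
    have ha : HasDerivAt (fun U : ℝ => U ^ θ) (θ * U ^ (θ - 1)) U :=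
      Real.hasDerivAt_rpow_const (Or.inl hU.1.ne')
    have hb : HasDerivAt (fun U : ℝ => (c - U) ^ θ) (-(θ * (c - U) ^ (θ - 1))) U := by
      have := (Real.hasDerivAt_rpow_const (p := θ) (Or.inl hcU.ne')).comp U
        ((hasDerivAt_id U).const_sub c)
      simpa [Function.comp_def] using! this
    have hlin : ∀ α β : ℝ, HasDerivAt (fun U : ℝ => f (x + α * U ^ θ + β * (c - U) ^ θ))
        (f1 (x + α * U ^ θ + β * (c - U) ^ θ) *
          (α * (θ * U ^ (θ - 1)) + β * (-(θ * (c - U) ^ (θ - 1))))) U := by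
      intro α β
      exact (hf.hasDeriv _).comp U (((ha.const_mul α).const_add x).add (hb.const_mul β))
    have h := (((hlin (1 - p) (1 - p)).const_mul p).add
        ((hlin (1 - p) (-p)).const_mul (1 - p))).const_mul p |>.add
      ((((hlin (-p) (1 - p)).const_mul p).add ((hlin (-p) (-p)).const_mul (1 - p))).const_mul
        (1 - p))
    have e1 : x - p * (U ^ θ + (c - U) ^ θ) + U ^ θ + (c - U) ^ θ =
      x + (1 - p) * U ^ θ + (1 - p) * (c - U) ^ θ := by ring
    have e2 : x - p * (U ^ θ + (c - U) ^ θ) + (c - U) ^ θ =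
      x + (-p) * U ^ θ + (1 - p) * (c - U) ^ θ := by ring
    have e3 : x - p * (U ^ θ + (c - U) ^ θ) + U ^ θ =
      x + (1 - p) * U ^ θ + (-p) * (c - U) ^ θ := by ring
    have e4 : x - p * (U ^ θ + (c - U) ^ θ) =
      x + (-p) * U ^ θ + (-p) * (c - U) ^ θ := by ring
    rw [e1, e2, e3, e4]
    refine (h.congr_deriv ?_).congr_of_eventuallyEq (.of_forall fun V => ?_)
    · ring
    · simp only [twoPointAvg, sub_eq_add_neg, neg_mul, Pi.add_apply]
  refine monotoneOn_of_deriv_nonneg (convex_Ioc _ _)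
    (fun U hU => (hd U hU).continuousAt.continuousWithinAt)
    (fun U hU => (hd U (interior_subset hU)).differentiableAt.differentiableWithinAt)
    fun U hU => ?_
  have hU := interior_subset hU
  have hcU : 0 < c - U := by linarith [hU.1, hU.2]
  rw [(hd U hU).deriv]
  refine mul_nonneg (by positivity) ?_
  have h := hf.deriv_comparison hp0 hp1 hm (Real.rpow_pos_of_pos hU.1 θ)
    (Real.rpow_le_rpow hU.1.le (by linarith [hU.2] : U ≤ c - U) hθ.le)
    (W := x - p * (U ^ θ + (c - U) ^ θ))
  -- Since `θ * (2 * m - 1) = 1 - θ`, the ratio of the derivatives of the two scales is exactly the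
  -- factor in `IsF3.deriv_comparison`.
  have hpow : (c - U) ^ (θ - 1) = U ^ (θ - 1) * (U ^ θ / (c - U) ^ θ) ^ (2 * m - 1) := by
    rw [← Real.div_rpow hU.1.le hcU.le, ← Real.rpow_mul (div_pos hU.1 hcU).le, hθm,
      ← neg_sub 1 θ, Real.rpow_neg hU.1.le, Real.rpow_neg hcU.le, Real.div_rpow hU.1.le hcU.le]
    have := (Real.rpow_pos_of_pos hU.1 (1 - θ)).ne'
    field_simp
  rw [hpow, mul_assoc, ← mul_sub]
  exact mul_nonneg (Real.rpow_nonneg hU.1.le _) (sub_nonneg.2 h)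

instance leftCommutative_twoPointAvg (p θ : ℝ) :
    LeftCommutative fun U => twoPointAvg p (U ^ θ) :=
  ⟨fun _ _ _ => twoPointAvg_comm _ _ _ _⟩

/-- The iterated two-point average whose scales are the `θ`-th powers of the members of a
multiset. -/
noncomputable def multiAvg (p θ : ℝ) (M : Multiset ℝ) (f : ℝ → ℝ) : ℝ → ℝ :=
  M.foldr (fun U => twoPointAvg p (U ^ θ)) f

@[simp] lemma multiAvg_zero (p θ : ℝ) (f : ℝ → ℝ) : multiAvg p θ 0 f = f := by
  simp [multiAvg]

lemma multiAvg_cons (p θ U : ℝ) (M : Multiset ℝ) (f : ℝ → ℝ) :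
    multiAvg p θ (U ::ₘ M) f = twoPointAvg p (U ^ θ) (multiAvg p θ M f) := by
  simp [multiAvg]

lemma multiAvg_cons' (p θ U : ℝ) (M : Multiset ℝ) (f : ℝ → ℝ) :
    multiAvg p θ (U ::ₘ M) f = multiAvg p θ M (twoPointAvg p (U ^ θ) f) := by
  induction M using Multiset.induction with
  | empty => simp [multiAvg]
  | cons V M ih => rw [Multiset.cons_swap, multiAvg_cons, ih, ← multiAvg_cons]

lemma multiAvg_coe (p θ : ℝ) (l : List ℝ) (f : ℝ → ℝ) :
    multiAvg p θ (l : Multiset ℝ) f = l.foldr (fun U => twoPointAvg p (U ^ θ)) f := by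
  simp [multiAvg]

lemma IsF3.multiAvg {f f1 f2 : ℝ → ℝ} (hf : IsF3 f f1 f2) {p : ℝ} (hp0 : 0 < p) (hp1 : p < 1)
    (θ : ℝ) (M : Multiset ℝ) :
    IsF3 (multiAvg p θ M f) (multiAvg p θ M f1) (multiAvg p θ M f2) := by
  induction M using Multiset.induction with
  | empty => simpa using hf
  | cons V M ih => simpa only [multiAvg_cons] using ih.avg hp0 hp1 _

/-- Replacing the members of a multiset by an upper bound for their mean increases the iterated
average. -/
lemma IsF3.multiAvg_le_replicate {f f1 f2 : ℝ → ℝ} (hf : IsF3 f f1 f2) {p m V : ℝ} (hp0 : 0 < p)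
    (hp1 : p < 1) (hm : mStar p ≤ m) (hV : 0 < V) (n : ℕ) :
    ∀ M : Multiset ℝ, M.card = n → (∀ U ∈ M, 0 < U) → M.sum ≤ n * V → ∀ x,
      _root_.multiAvg p (1 / (2 * m)) M f x ≤
        _root_.multiAvg p (1 / (2 * m)) (Multiset.replicate n V) f x := by
  have hm0 : 0 < m := zero_lt_one.trans_le ((one_le_mStar hp0).trans hm)
  have hθ : 0 < 1 / (2 * m) := by positivity
  induction n with
  | zero =>
    intro M hM _ _ x
    rw [Multiset.card_eq_zero.1 hM, Multiset.replicate_zero]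
  | succ n ih =>
    intro M hM hpos hsum x
    rw [Multiset.replicate_succ]
    suffices h : ∃ M' : Multiset ℝ, M'.card = n ∧ (∀ U ∈ M', 0 < U) ∧ M'.sum ≤ n * V ∧
        _root_.multiAvg p (1 / (2 * m)) M f x ≤ _root_.multiAvg p (1 / (2 * m)) (V ::ₘ M') f x by
      obtain ⟨M', h1, h2, h3, h4⟩ := h
      refine h4.trans ?_
      rw [multiAvg_cons, multiAvg_cons]
      exact twoPointAvg_mono hp0 hp1 _ (fun y => ih M' h1 h2 h3 y) x
    -- If no member exceeds `V`, raise one to `V`. Otherwise some `U > V` and `W < V` exist, and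
    -- replacing them by `V` and `U + W - V` keeps their sum and brings them closer.
    by_cases hall : ∀ U ∈ M, U ≤ V
    · obtain ⟨U, hU⟩ := Multiset.card_pos_iff_exists_mem.1 (by omega : 0 < M.card)
      obtain ⟨M', rfl⟩ := Multiset.exists_cons_of_mem hU
      refine ⟨M', by simpa using hM, fun W hW => hpos W (Multiset.mem_cons_of_mem hW), ?_, ?_⟩
      · have := Multiset.sum_le_card_nsmul M' V fun W hW => hall W (Multiset.mem_cons_of_mem hW)
        rw [nsmul_eq_mul] at this
        have h1 : M'.card = n := by simpa using hM
        rwa [h1] at this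
      · rw [multiAvg_cons, multiAvg_cons]
        exact (hf.multiAvg hp0 hp1 _ M').twoPointAvg_mono_scale hp0 hp1
          (Real.rpow_pos_of_pos (hpos U hU) _) (Real.rpow_le_rpow (hpos U hU).le (hall U hU) hθ.le) x
    · push Not at hall
      obtain ⟨U, hU, hVU⟩ := hall
      obtain ⟨M₁, rfl⟩ := Multiset.exists_cons_of_mem hU
      have hM₁ : M₁.card = n := by simpa using hM
      have hex : ∃ W ∈ M₁, W < V := by
        by_contra! hcon
        have := Multiset.card_nsmul_le_sum hcon
        rw [nsmul_eq_mul, hM₁] at this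
        rw [Multiset.sum_cons] at hsum
        push_cast at hsum
        linarith
      obtain ⟨W, hW, hWV⟩ := hex
      obtain ⟨M₂, rfl⟩ := Multiset.exists_cons_of_mem hW
      have hW0 : 0 < W := hpos W (by simp)
      refine ⟨(U + W - V) ::ₘ M₂, by simpa using hM₁, ?_, ?_, ?_⟩
      · intro Z hZ
        rcases Multiset.mem_cons.1 hZ with rfl | hZ
        · linarith
        · exact hpos Z (by simp [hZ])
      · simp only [Multiset.sum_cons] at hsum ⊢
        push_cast at hsum
        linarith
      · have hmono := (hf.multiAvg hp0 hp1 (1 / (2 * m)) M₂).monotoneOn_pair (c := U + W) hp0 hp1 hm x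
        rw [Multiset.cons_swap]
        simp only [multiAvg_cons]
        have hWm : W ∈ Set.Ioc 0 ((U + W) / 2) := ⟨hW0, by linarith⟩
        -- The monotonicity is stated for the smaller member of a pair, which may be `V` or `U + W -
        -- V`.
        rcases le_total V ((U + W) / 2) with h | h
        · have := hmono hWm ⟨hV, h⟩ hWV.le
          simpa only [add_sub_cancel_right] using this
        · have := hmono hWm (⟨by linarith, by linarith⟩ : U + W - V ∈ Set.Ioc 0 ((U + W) / 2))
            (by linarith)
          rw [twoPointAvg_comm p (V ^ _)]
          simpa only [add_sub_cancel_right, sub_sub_cancel] using this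

/-! ### Sums of standardized Bernoulli variables as iterated averages. -/

/-- The reciprocal `1 / √(pq)` of the standard deviation of the Bernoulli distribution. -/
noncomputable def invSd (p : ℝ) : ℝ := 1 / √(p * (1 - p))

section invSd
variable {p : ℝ}

lemma invSd_pos (hp0 : 0 < p) (hp1 : p < 1) : 0 < invSd p :=
  one_div_pos.2 (Real.sqrt_pos.2 (mul_pos hp0 (by linarith)))

lemma mul_invSd_sq (hp0 : 0 < p) (hp1 : p < 1) : p * (1 - p) * invSd p ^ 2 = 1 := by
  have : 0 < p * (1 - p) := mul_pos hp0 (by linarith)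
  rw [invSd, div_pow, Real.sq_sqrt this.le, one_pow, mul_one_div_cancel this.ne']

lemma sqrt_div_eq_mul_invSd (hp0 : 0 < p) (hp1 : p < 1) :
    √((1 - p) / p) = (1 - p) * invSd p := by
  have hq : 0 < 1 - p := by linarith
  have hk := invSd_pos hp0 hp1
  rw [Real.sqrt_eq_iff_mul_self_eq (by positivity) (by positivity), div_eq_iff hp0.ne']
  linear_combination -(1 - p) * mul_invSd_sq hp0 hp1

lemma sqrt_div_eq_mul_invSd' (hp0 : 0 < p) (hp1 : p < 1) :
    √(p / (1 - p)) = p * invSd p := by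
  have hq : 0 < 1 - p := by linarith
  have hk := invSd_pos hp0 hp1
  rw [Real.sqrt_eq_iff_mul_self_eq (by positivity) (by positivity), div_eq_iff hq.ne']
  linear_combination -p * mul_invSd_sq hp0 hp1

end invSd

lemma stdBernoulli_eq {p : ℝ} (hp0 : 0 < p) (hp1 : p < 1) :
    stdBernoulli p = ENNReal.ofReal p • Measure.dirac ((1 - p) * invSd p) +
      ENNReal.ofReal (1 - p) • Measure.dirac (-(p * invSd p)) := by
  rw [stdBernoulli, sqrt_div_eq_mul_invSd hp0 hp1, sqrt_div_eq_mul_invSd' hp0 hp1]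

lemma isProbabilityMeasure_stdBernoulli {p : ℝ} (hp0 : 0 < p) (hp1 : p < 1) :
    IsProbabilityMeasure (stdBernoulli p) := by
  refine ⟨?_⟩
  rw [stdBernoulli]
  simp only [Measure.coe_add, Measure.coe_smul, Pi.add_apply, Pi.smul_apply, measure_univ,
    smul_eq_mul, mul_one]
  rw [← ENNReal.ofReal_add hp0.le (by linarith)]
  simp

/-- The expectation of a continuous function of a weighted sum of independent standardized
Bernoulli variables is an iterated two-point average. -/
lemma integral_weighted_sum {p : ℝ} (hp0 : 0 < p) (hp1 : p < 1) {Ω : Type*} [MeasurableSpace Ω]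
    {P : Measure Ω} [IsProbabilityMeasure P] {n : ℕ} :
    ∀ {BS : Fin n → Ω → ℝ} (_ : IsIIDStdBernoulli P p BS) (c : Fin n → ℝ) {f : ℝ → ℝ}
      (_ : Continuous f) (x : ℝ),
      Integrable (fun ω => f (x + ∑ i, c i * BS i ω)) P ∧
      ∫ ω, f (x + ∑ i, c i * BS i ω) ∂P =
        (List.ofFn c).foldr (fun c => twoPointAvg p (invSd p * c)) f x := by
  induction n with
  | zero => intro BS _ c f _ x; simp
  | succ n ih =>
    intro BS hBS c f hf x
    have hBS' : IsIIDStdBernoulli P p (fun i : Fin n => BS i.succ) :=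
      ⟨fun i => hBS.law _, hBS.indep.precomp (Fin.succ_injective n)⟩
    set Y : Ω → ℝ := fun ω => ∑ i : Fin n, c i.succ * BS i.succ ω with hY
    have hm : ∀ i, AEMeasurable (BS i) P := fun i => (hBS.law i).aemeasurable
    have hYm : AEMeasurable Y P := by
      refine Finset.aemeasurable_fun_sum _ fun i _ => (hm _).const_mul _
    have hind : IndepFun (BS 0) Y P := by
      -- The weight at index zero is `1`, not `c 0`, so that independence is obtained for `BS 0`
      -- itself.
      let d : Fin (n + 1) → ℝ := Fin.cons 1 fun i => c i.succ
      have h1 : iIndepFun (fun i => (fun y => d i * y) ∘ BS i) P :=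
        hBS.indep.comp (fun i y => d i * y) fun i => measurable_const_mul _
      have h2 := h1.indepFun_finsetSum_of_notMem₀ (fun i => (hm i).const_mul (d i))
        (s := Finset.univ.map (Fin.succEmb n)) (i := 0) (by simp)
      have e1 : (fun y => d 0 * y) ∘ BS 0 = BS 0 := by
        funext ω; simp [d]
      have e2 : (∑ j ∈ Finset.univ.map (Fin.succEmb n), (fun y => d j * y) ∘ BS j) = Y := by
        funext ω; simp [d, hY]
      rw [e1, e2] at h2
      exact h2.symm
    have hprob : IsProbabilityMeasure (P.map Y) := Measure.isProbabilityMeasure_map hYm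
    have hmap : P.map (fun ω => (BS 0 ω, Y ω)) =
        ENNReal.ofReal p • (P.map Y).map (Prod.mk ((1 - p) * invSd p)) +
        ENNReal.ofReal (1 - p) • (P.map Y).map (Prod.mk (-(p * invSd p))) := by
      rw [(indepFun_iff_map_prod_eq_prod_map_map (hm 0) hYm).1 hind, (hBS.law 0).map_eq,
        stdBernoulli_eq hp0 hp1, Measure.add_prod, Measure.prod_smul_left,
        Measure.prod_smul_left, Measure.dirac_prod, Measure.dirac_prod]
    set g : ℝ × ℝ → ℝ := fun z => f (x + (c 0 * z.1 + z.2)) with hg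
    have hgc : Continuous g := by fun_prop
    have hval : ∀ z, Integrable g ((P.map Y).map (Prod.mk z)) ∧
        ∫ y, g y ∂((P.map Y).map (Prod.mk z)) =
          (List.ofFn fun i => c i.succ).foldr (fun c => twoPointAvg p (invSd p * c)) f
            (x + c 0 * z) := by
      intro z
      obtain ⟨h1, h2⟩ := ih hBS' (fun i => c i.succ) hf (x + c 0 * z)
      have hmk : AEMeasurable (Prod.mk z) (P.map Y) := measurable_prodMk_left.aemeasurable
      constructor
      · rw [integrable_map_measure hgc.aestronglyMeasurable hmk,
          integrable_map_measure (by exact (hgc.comp (by fun_prop)).aestronglyMeasurable) hYm]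
        simpa [Function.comp_def, hg, hY, add_assoc] using h1
      · rw [integral_map hmk hgc.aestronglyMeasurable,
          integral_map (f := fun y => g (z, y)) hYm (hgc.comp (by fun_prop : Continuous fun y : ℝ => (z, y))).aestronglyMeasurable,
          ← h2]
        simp [hg, hY, add_assoc]
    have hpair : AEMeasurable (fun ω => (BS 0 ω, Y ω)) P := (hm 0).prodMk hYm
    have hi1 := (hval ((1 - p) * invSd p)).1.smul_measure (ENNReal.ofReal_ne_top (r := p))
    have hi2 := (hval (-(p * invSd p))).1.smul_measure (ENNReal.ofReal_ne_top (r := 1 - p))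
    have e : (fun ω => f (x + ∑ i, c i * BS i ω)) = g ∘ fun ω => (BS 0 ω, Y ω) := by
      funext ω
      simp [hg, hY, Fin.sum_univ_succ]
    constructor
    · rw [e, ← integrable_map_measure hgc.aestronglyMeasurable hpair, hmap]
      exact hi1.add_measure hi2
    · rw [e]
      simp only [Function.comp_def]
      rw [← integral_map hpair hgc.aestronglyMeasurable, hmap, integral_add_measure hi1 hi2,
        integral_smul_measure, integral_smul_measure, (hval _).2, (hval _).2,
        ENNReal.toReal_ofReal hp0.le, ENNReal.toReal_ofReal (by linarith), List.ofFn_succ,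
        List.foldr_cons]
      simp only [twoPointAvg, smul_eq_mul]
      congr 3 <;> ring_nf

/-! ### One step of the supermartingale. -/

lemma ConvexOn.le_chord {f : ℝ → ℝ} (hf : ConvexOn ℝ Set.univ f) {x A B d : ℝ} (hA : 0 < A)
    (hB : 0 < B) (h1 : -A ≤ d) (h2 : d ≤ B) :
    f (x + d) ≤ (B * f (x - A) + A * f (x + B)) / (A + B)
      + (f (x + B) - f (x - A)) / (A + B) * d := by
  have hAB : 0 < A + B := by linarith
  have h := hf.2 (Set.mem_univ (x - A)) (Set.mem_univ (x + B))
    (div_nonneg (by linarith : 0 ≤ B - d) hAB.le) (div_nonneg (by linarith : 0 ≤ A + d) hAB.le)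
    (by field_simp; ring)
  simp only [smul_eq_mul] at h
  have e : (B - d) / (A + B) * (x - A) + (A + d) / (A + B) * (x + B) = x + d := by
    field_simp; ring
  rw [e] at h
  refine h.trans_eq ?_
  field_simp
  ring

section Step
variable {f f1 f2 : ℝ → ℝ} {Ω : Type*} {m0 : MeasurableSpace Ω} {μ : Measure Ω}

/-- `S` may be unbounded below, so the lower bound is the tangent line of `f` at `0`, which is
integrable along `S`. -/
lemma IsF3.integrable_comp [IsFiniteMeasure μ] (hf : IsF3 f f1 f2) {S : Ω → ℝ} {C : ℝ}
    (hS : Integrable S μ) (hC : ∀ᵐ ω ∂μ, S ω ≤ C) : Integrable (fun ω => f (S ω)) μ := by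
  refine integrable_of_le_of_le (g₁ := fun ω => f 0 + f1 0 * S ω) (g₂ := fun _ => f C)
    (hf.continuous.comp_aestronglyMeasurable hS.1) (.of_forall fun ω => ?_)
    (hC.mono fun ω h => hf.mono h) ((integrable_const _).add (hS.const_mul _)) (integrable_const _)
  have := hf.taylor 0 (S ω)
  have h0 : 0 ≤ ∫ s in (0:ℝ)..1, (1 - s) * f2 (0 + s * S ω) :=
    intervalIntegral.integral_nonneg zero_le_one fun s hs =>
      mul_nonneg (by linarith [hs.2]) (hf.nonneg2 _)
  rw [zero_add] at this
  have := mul_nonneg (sq_nonneg (S ω)) h0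
  simp only
  linarith

/-- One step of the comparison for a supermartingale. -/
lemma IsF3.integral_step_le [IsProbabilityMeasure μ] (hf : IsF3 f f1 f2) {m : MeasurableSpace Ω}
    (hm : m ≤ m0) {S S' A B : Ω → ℝ} {p u C : ℝ} (hp0 : 0 < p) (hp1 : p < 1) (hu : 0 ≤ u)
    (hS : StronglyMeasurable[m] S) (hSi : Integrable S μ) (hSi' : Integrable S' μ)
    (hce : μ[S' | m] ≤ᵐ[μ] S) (hAm : Measurable[m] A) (hBm : Measurable[m] B)
    (hA : ∀ᵐ ω ∂μ, 0 < A ω) (hB : ∀ᵐ ω ∂μ, 0 < B ω) (h1 : ∀ᵐ ω ∂μ, -A ω ≤ S' ω - S ω)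
    (h2 : ∀ᵐ ω ∂μ, S' ω - S ω ≤ B ω) (hAB : ∀ᵐ ω ∂μ, A ω * B ω ≤ p * (1 - p) * u ^ 2)
    (hBA : ∀ᵐ ω ∂μ, B ω / A ω ≤ (1 - p) / p) (hC : ∀ᵐ ω ∂μ, S ω ≤ C) :
    ∫ ω, f (S' ω) ∂μ ≤ ∫ ω, twoPointAvg p u f (S ω) ∂μ := by
  have hBu : ∀ᵐ ω ∂μ, B ω ≤ (1 - p) * u := by
    filter_upwards [hA, hB, hAB, hBA] with ω a b ab ba
    exact upper_le_of_asymmetry hp0 hp1 hu a b ab ba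
  have hC' : ∀ᵐ ω ∂μ, S' ω ≤ C + (1 - p) * u := by
    filter_upwards [hC, h2, hBu] with ω a b c
    linarith
  -- The chord slope is known at the earlier time, nonnegative and bounded, so it can be pulled out
  -- of the conditional expectation, and its product with the increment has nonpositive mean.
  let sl : Ω → ℝ := fun ω => (f (S ω + B ω) - f (S ω - A ω)) / (A ω + B ω)
  have hslm : StronglyMeasurable[m] sl := by
    have hSm := hS.measurable
    have hfm := hf.continuous.measurable
    exact Measurable.stronglyMeasurable
      (((hfm.comp (hSm.add hBm)).sub (hfm.comp (hSm.sub hAm))).div (hAm.add hBm))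
  have hsl0 : ∀ᵐ ω ∂μ, 0 ≤ sl ω := by
    filter_upwards [hA, hB] with ω a b
    exact div_nonneg (sub_nonneg.2 (hf.mono (by linarith))) (by linarith)
  have hslC : ∀ᵐ ω ∂μ, ‖sl ω‖ ≤ f1 (C + (1 - p) * u) := by
    filter_upwards [hA, hB, hC, hBu, hsl0] with ω a b c d e
    rw [Real.norm_of_nonneg e]
    have hlt : S ω - A ω < S ω + B ω := by linarith
    have := hf.convex.slope_le_of_hasDerivAt (Set.mem_univ (S ω - A ω)) (Set.mem_univ (S ω + B ω)) hlt
      (hf.hasDeriv _)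
    rw [slope_def_field] at this
    refine le_trans (le_of_eq ?_) (this.trans (hf.mono1 (by linarith)))
    simp only [sl]
    congr 1
    ring
  have hX : Integrable (S' - S) μ := hSi'.sub hSi
  have hslX : Integrable (sl * (S' - S)) μ :=
    hX.bdd_mul (hslm.mono hm).aestronglyMeasurable hslC
  have hneg : ∫ ω, (sl * (S' - S)) ω ∂μ ≤ 0 := by
    rw [← integral_condExp hm]
    refine integral_nonpos_of_ae ?_
    have e1 := condExp_mul_of_stronglyMeasurable_left hslm hslX hX
    have e2 := condExp_sub hSi' hSi m
    rw [condExp_of_stronglyMeasurable hm hS hSi] at e2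
    filter_upwards [e1, e2, hce, hsl0] with ω a b c d
    rw [a, Pi.mul_apply, b]
    exact mul_nonpos_of_nonneg_of_nonpos d (by simpa using c)
  have hi1 := hf.integrable_comp hSi' hC'
  have hi2 := (hf.avg hp0 hp1 u).integrable_comp hSi hC
  calc ∫ ω, f (S' ω) ∂μ ≤ ∫ ω, (twoPointAvg p u f (S ω) + (sl * (S' - S)) ω) ∂μ := by
        refine integral_mono_ae hi1 (hi2.add hslX) ?_
        filter_upwards [hA, hB, h1, h2, hAB, hBA] with ω a b c d ab ba
        have := hf.convex.le_chord (x := S ω) a b c d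
        rw [add_sub_cancel] at this
        exact this.trans (add_le_add_left (hf.two_point_le hp0 hp1 hu a b ab ba _) _)
    _ = ∫ ω, twoPointAvg p u f (S ω) ∂μ + ∫ ω, (sl * (S' - S)) ω ∂μ := integral_add hi2 hslX
    _ ≤ _ := by linarith

end Step

/-! ### Iterating the steps; the comparison inequality. -/

lemma IsBoundedAsymmetrySupermartingale.scale_pos {Ω : Type*} {mΩ : MeasurableSpace Ω}
    {μ : Measure Ω} [IsProbabilityMeasure μ] {ℱ : Filtration ℕ mΩ} {p : ℝ} {n : ℕ}
    {S A B : ℕ → Ω → ℝ} {c : Fin n → ℝ}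
    (h : IsBoundedAsymmetrySupermartingale μ ℱ p n S A B c) (i : Fin n) : 0 < c i := by
  obtain ⟨ω, ha, hb, hc⟩ := ((h.pos_A i).and ((h.pos_B i).and (h.sqrt_mul_le i))).exists
  exact (Real.sqrt_pos.2 (mul_pos ha hb)).trans_le hc

lemma IsBoundedAsymmetrySupermartingale.mul_le {Ω : Type*} {mΩ : MeasurableSpace Ω}
    {μ : Measure Ω} [IsProbabilityMeasure μ] {ℱ : Filtration ℕ mΩ} {p : ℝ} {n : ℕ}
    {S A B : ℕ → Ω → ℝ} {c : Fin n → ℝ} (hp0 : 0 < p) (hp1 : p < 1)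
    (h : IsBoundedAsymmetrySupermartingale μ ℱ p n S A B c) (i : Fin n) :
    ∀ᵐ ω ∂μ, A i ω * B i ω ≤ p * (1 - p) * (invSd p * c i) ^ 2 := by
  filter_upwards [h.sqrt_mul_le i] with ω hω
  rw [Real.sqrt_le_left (h.scale_pos i).le] at hω
  linarith [congrArg (· * c i ^ 2) (mul_invSd_sq hp0 hp1)]

lemma IsBoundedAsymmetrySupermartingale.bounded_above {Ω : Type*} {mΩ : MeasurableSpace Ω}
    {μ : Measure Ω} [IsProbabilityMeasure μ] {ℱ : Filtration ℕ mΩ} {p : ℝ} {n : ℕ}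
    {S A B : ℕ → Ω → ℝ} {c : Fin n → ℝ} (hp0 : 0 < p) (hp1 : p < 1)
    (h : IsBoundedAsymmetrySupermartingale μ ℱ p n S A B c) (k : ℕ) (hk : k ≤ n) :
    ∃ C, ∀ᵐ ω ∂μ, S k ω ≤ C := by
  induction k with
  | zero => exact ⟨0, h.init_nonpos⟩
  | succ k ih =>
    obtain ⟨C, hC⟩ := ih (by omega)
    let i : Fin n := ⟨k, hk⟩
    refine ⟨C + (1 - p) * (invSd p * c i), ?_⟩
    filter_upwards [hC, h.pos_A i, h.pos_B i, h.mul_le hp0 hp1 i, h.div_le i, h.diff_le_B i]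
      with ω a b c d e f
    have := upper_le_of_asymmetry hp0 hp1
      (mul_pos (invSd_pos hp0 hp1) (h.scale_pos i)).le b c d e
    simp only [i] at f this
    linarith

/-- Comparison of a supermartingale with the sum of independent two-point variables. -/
lemma IsBoundedAsymmetrySupermartingale.integral_le_multiAvg {Ω : Type*} {mΩ : MeasurableSpace Ω}
    {μ : Measure Ω} [IsProbabilityMeasure μ] {ℱ : Filtration ℕ mΩ} {p θ : ℝ} {n : ℕ}
    {S A B : ℕ → Ω → ℝ} {c : Fin n → ℝ} (hp0 : 0 < p) (hp1 : p < 1)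
    (h : IsBoundedAsymmetrySupermartingale μ ℱ p n S A B c) {U : ℕ → ℝ}
    (hU : ∀ i : Fin n, U i ^ θ = invSd p * c i) (k : ℕ) (hk : k ≤ n) :
    ∀ {f f1 f2 : ℝ → ℝ}, IsF3 f f1 f2 →
      ∫ ω, f (S k ω) ∂μ ≤ multiAvg p θ ((Multiset.range k).map U) f 0 := by
  induction k with
  | zero =>
    intro f f1 f2 hf
    have hi := hf.integrable_comp (h.supermartingale.integrable 0) h.init_nonpos
    have := integral_mono_ae hi (integrable_const (f 0)) (h.init_nonpos.mono fun ω hω => hf.mono hω)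
    simpa using this
  | succ k ih =>
    intro f f1 f2 hf
    let i : Fin n := ⟨k, hk⟩
    obtain ⟨C, hC⟩ := h.bounded_above hp0 hp1 k (by omega)
    have hs := h.supermartingale
    rw [Multiset.range_succ, Multiset.map_cons, multiAvg_cons', hU i]
    -- The last step is averaged out and the induction hypothesis is applied to the averaged
    -- function, hence the quantification over all `f`.
    refine le_trans ?_ (ih (by omega) (hf.avg hp0 hp1 _))
    exact hf.integral_step_le (ℱ.le k) hp0 hp1
      (mul_pos (invSd_pos hp0 hp1) (h.scale_pos i)).le (hs.stronglyMeasurable k)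
      (hs.integrable k) (hs.integrable (k + 1)) (hs.condExp_ae_le (Nat.le_succ k))
      (h.measurable_A i) (h.measurable_B i) (h.pos_A i) (h.pos_B i) (h.neg_A_le_diff i)
      (h.diff_le_B i) (h.mul_le hp0 hp1 i) (h.div_le i) hC

lemma foldr_replicate_congr {α β γ : Type*} {F : α → β → β} {G : γ → β → β} {a : α} {b : γ}
    (h : F a = G b) (n : ℕ) (x : β) :
    (List.replicate n a).foldr F x = (List.replicate n b).foldr G x := by
  induction n with
  | zero => rfl
  | succ n ih => simp only [List.replicate_succ, List.foldr_cons, ih, h]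

/-- The comparison inequality. -/
theorem comparison_inequality {p m : ℝ} (hp0 : 0 < p) (hp1 : p < 1) (hm : mStar p ≤ m) {n : ℕ}
    (hn : 1 ≤ n) {Ω : Type*} {mΩ : MeasurableSpace Ω} {μ : Measure Ω} [IsProbabilityMeasure μ]
    {ℱ : Filtration ℕ mΩ} {S A B : ℕ → Ω → ℝ} {c : Fin n → ℝ}
    (h : IsBoundedAsymmetrySupermartingale μ ℱ p n S A B c)
    {Ω' : Type*} [MeasurableSpace Ω'] {P : Measure Ω'} [IsProbabilityMeasure P]
    {BS : Fin n → Ω' → ℝ} (hBS : IsIIDStdBernoulli P p BS) {f : ℝ → ℝ} (hf : f ∈ classF3) :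
    Integrable (fun ω => f (S n ω)) μ ∧
    Integrable (fun ω' => f (powerMean m c * ∑ i, BS i ω')) P ∧
    ∫ ω, f (S n ω) ∂μ ≤ ∫ ω', f (powerMean m c * ∑ i, BS i ω') ∂P := by
  obtain ⟨f1, f2, hf⟩ := exists_isF3_of_mem_classF3 hf
  obtain ⟨C, hC⟩ := h.bounded_above hp0 hp1 n le_rfl
  have hm0 : 0 < m := zero_lt_one.trans_le ((one_le_mStar hp0).trans hm)
  have hk := invSd_pos hp0 hp1
  have hc := h.scale_pos
  have hn0 : (0:ℝ) < n := by exact_mod_cast hn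
  obtain ⟨h1, h2⟩ := integral_weighted_sum hp0 hp1 hBS (fun _ => powerMean m c) hf.continuous 0
  simp only [zero_add, ← Finset.mul_sum] at h1 h2
  refine ⟨hf.integrable_comp (h.supermartingale.integrable n) hC, h1, ?_⟩
  rw [h2]
  -- The value `1` outside the range is never used.
  let U : ℕ → ℝ := fun i => if hi : i < n then (invSd p * c ⟨i, hi⟩) ^ (2 * m) else 1
  have hUi : ∀ i : Fin n, U i = (invSd p * c i) ^ (2 * m) := fun i => by simp [U]
  have hinv : 2 * m * (1 / (2 * m)) = 1 := by field_simp
  have hU : ∀ i : Fin n, U i ^ (1 / (2 * m)) = invSd p * c i := fun i => by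
    rw [hUi, ← Real.rpow_mul (mul_pos hk (hc i)).le, hinv, Real.rpow_one]
  refine (h.integral_le_multiAvg hp0 hp1 hU n le_rfl hf).trans ?_
  have hsum : 0 < ∑ i, c i ^ (2 * m) :=
    Finset.sum_pos (fun i _ => Real.rpow_pos_of_pos (hc i) _) ⟨⟨0, hn⟩, Finset.mem_univ _⟩
  set V : ℝ := invSd p ^ (2 * m) * ((1 / (n : ℝ)) * ∑ i, c i ^ (2 * m)) with hV
  have hkV : 0 < invSd p ^ (2 * m) := Real.rpow_pos_of_pos hk _
  have hV0 : 0 < V := by positivity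
  have hVθ : V ^ (1 / (2 * m)) = invSd p * powerMean m c := by
    rw [hV, Real.mul_rpow hkV.le (by positivity), ← Real.rpow_mul hk.le, hinv, Real.rpow_one,
      powerMean]
  refine (hf.multiAvg_le_replicate hp0 hp1 hm hV0 n _ (by simp) ?_ ?_ 0).trans (le_of_eq ?_)
  · intro W hW
    obtain ⟨i, hi, rfl⟩ := Multiset.mem_map.1 hW
    rw [hUi ⟨i, Multiset.mem_range.1 hi⟩]
    exact Real.rpow_pos_of_pos (mul_pos hk (hc _)) _
  · have e : ((Multiset.range n).map U).sum = ∑ i ∈ Finset.range n, U i := rfl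
    rw [e, Finset.sum_range, hV]
    simp only [hUi, Real.mul_rpow hk.le (hc _).le, ← Finset.mul_sum]
    refine le_of_eq ?_
    field_simp
  · rw [← Multiset.coe_replicate, multiAvg_coe, List.ofFn_const]
    rw [foldr_replicate_congr (G := fun c => twoPointAvg p (invSd p * c)) (b := powerMean m c)]
    simp only [hVθ]

/-! ### Truncated cubes as test functions. -/

lemma hasDerivAt_max_zero_pow (n : ℕ) (x : ℝ) :
    HasDerivAt (fun x : ℝ => max x 0 ^ (n + 2)) ((n + 2) * max x 0 ^ (n + 1)) x := by
  have hne : ∀ y : ℝ, y ≠ 0 →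
      HasDerivAt (fun x : ℝ => max x 0 ^ (n + 2)) ((n + 2) * max y 0 ^ (n + 1)) y := by
    intro y hy
    rcases lt_or_gt_of_ne hy with h | h
    · have e : (fun x : ℝ => max x 0 ^ (n + 2)) =ᶠ[nhds y] fun _ => 0 := by
        filter_upwards [gt_mem_nhds h] with z hz
        simp [max_eq_right hz.le]
      refine ((hasDerivAt_const y (0:ℝ)).congr_of_eventuallyEq e).congr_deriv ?_
      simp [max_eq_right h.le]
    · have e : (fun x : ℝ => max x 0 ^ (n + 2)) =ᶠ[nhds y] fun x => x ^ (n + 2) := by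
        filter_upwards [lt_mem_nhds h] with z hz
        rw [max_eq_left hz.le]
      refine ((hasDerivAt_pow (n + 2) y).congr_of_eventuallyEq e).congr_deriv ?_
      rw [max_eq_left h.le]
      push_cast
      rfl
  by_cases hx : x = 0
  · subst hx
    refine hasDerivAt_of_hasDerivAt_of_ne (g := fun x : ℝ => (n + 2) * max x 0 ^ (n + 1))
      (fun y hy => hne y hy) ?_ ?_
    · exact Continuous.continuousAt (by fun_prop)
    · exact Continuous.continuousAt (by fun_prop)
  · exact hne x hx

/-- The truncated cube `(x - t)₊ ^ 3`. -/
def truncCube (t x : ℝ) : ℝ := max (x - t) 0 ^ 3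

lemma truncCube_mem_classF3 (t : ℝ) : truncCube t ∈ classF3 := by
  have h1 : ∀ x, HasDerivAt (truncCube t) (3 * max (x - t) 0 ^ 2) x := fun x => by
    have := (hasDerivAt_max_zero_pow 1 (x - t)).comp_sub_const x t
    refine HasDerivAt.congr_deriv this ?_
    norm_num
  have h2 : ∀ x, HasDerivAt (fun x => 3 * max (x - t) 0 ^ 2) (6 * max (x - t) 0) x := fun x => by
    have := ((hasDerivAt_max_zero_pow 0 (x - t)).comp_sub_const x t).const_mul 3
    refine HasDerivAt.congr_deriv this ?_
    norm_num
    ring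
  have d1 : deriv (truncCube t) = fun x => 3 * max (x - t) 0 ^ 2 := funext fun x => (h1 x).deriv
  have d2 : deriv (fun x => 3 * max (x - t) 0 ^ 2) = fun x => 6 * max (x - t) 0 :=
    funext fun x => (h2 x).deriv
  have e2 : iteratedDeriv 2 (truncCube t) = fun x => 6 * max (x - t) 0 := by
    rw [iteratedDeriv_succ, iteratedDeriv_one, d1, d2]
  have hconv : ConvexOn ℝ Set.univ fun x : ℝ => max (x - t) 0 := by
    refine ConvexOn.sup (f := fun x : ℝ => x - t) (g := fun _ => 0) ?_ (convexOn_const 0 convex_univ)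
    exact (convexOn_id convex_univ).sub (concaveOn_const t convex_univ)
  have hmono : Monotone fun x : ℝ => max (x - t) 0 := fun x y h =>
    max_le_max (by linarith) le_rfl
  refine ⟨?_, ?_, ?_, ?_, ?_⟩
  · rw [show (2 : WithTop ℕ∞) = 1 + 1 by norm_num, contDiff_succ_iff_deriv]
    refine ⟨fun x => (h1 x).differentiableAt, by simp, ?_⟩
    rw [d1, contDiff_one_iff_deriv, d2]
    exact ⟨fun x => (h2 x).differentiableAt, by fun_prop⟩
  · exact fun x y h => pow_le_pow_left₀ (le_max_right _ _) (hmono h) 3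
  · exact hconv.pow (fun _ _ => le_max_right _ _) 3
  · rw [e2]
    exact fun x y h => mul_le_mul_of_nonneg_left (hmono h) (by norm_num)
  · rw [e2]
    exact hconv.smul (by norm_num : (0:ℝ) ≤ 6)

/-! ### First-order effect of spreading two equal scales. -/

lemma eventually_pos_of_hasDerivAt {ψ : ℝ → ℝ} {D : ℝ} (h : HasDerivAt ψ D 0) (h0 : ψ 0 = 0)
    (hD : 0 < D) : ∀ᶠ w in nhdsWithin 0 (Set.Ioi 0), 0 < ψ w := by
  have h1 := (hasDerivAt_iff_tendsto_slope.1 h).eventually (lt_mem_nhds hD)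
  have h2 := h1.filter_mono
    (nhdsWithin_mono (0:ℝ) (fun x (hx : 0 < x) => hx.ne' : Set.Ioi (0:ℝ) ⊆ {0}ᶜ))
  filter_upwards [h2, self_mem_nhdsWithin] with w hw hw0
  rw [slope_def_field, h0, sub_zero, sub_zero] at hw
  exact (div_pos_iff_of_pos_right hw0).1 hw

/-- Both sides agree at `w = 0`, and `hD` says that the derivative of their difference there is
positive. The factor `e` is `0` when the lowest atom is truncated away and `1` when it counts. -/
lemma eventually_cubic_pos {p m t e : ℝ}
    (hD : 0 < 6 * p * (1 - p) * (2 * (1 - 2 * p - t)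
      - (2 * m - 1) * (p * (2 * (1 - p) - t) ^ 2 + (1 - 2 * p) * (1 - 2 * p - t) ^ 2
        - e * (1 - p) * (-2 * p - t) ^ 2))) :
    ∀ᶠ w in nhdsWithin (0:ℝ) (Set.Ioi 0),
      p ^ 2 * (2 * (1 - p) * Real.exp (2 * m * w) - t) ^ 3
        + 2 * p * (1 - p) * ((1 - 2 * p) * Real.exp (2 * m * w) - t) ^ 3
        + e * (1 - p) ^ 2 * (-2 * p * Real.exp (2 * m * w) - t) ^ 3 <
      p ^ 2 * (2 * (1 - p) * (1 + w) - t) ^ 3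
        + 2 * p * (1 - p) * (((1 - 2 * p) * (1 + w) - t) ^ 3
          + 3 * ((1 - 2 * p) * (1 + w) - t) * (2 * w + w ^ 2))
        + e * (1 - p) ^ 2 * (-2 * p * (1 + w) - t) ^ 3 := by
  have hr : HasDerivAt (fun w => Real.exp (2 * m * w)) (2 * m) 0 := by
    simpa using ((hasDerivAt_id (0:ℝ)).const_mul (2 * m)).exp
  have hw : HasDerivAt (fun w : ℝ => 1 + w) 1 0 := (hasDerivAt_id _).const_add 1
  have hcube : ∀ {r : ℝ → ℝ} {r' : ℝ} (_ : HasDerivAt r r' 0) (_ : r 0 = 1) (α : ℝ),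
      HasDerivAt (fun w => (α * r w - t) ^ 3) (3 * (α - t) ^ 2 * (α * r')) 0 := by
    intro r r' h h0 α
    refine HasDerivAt.congr_deriv (((h.const_mul α).sub_const t).pow 3) ?_
    simp [h0]
  have hq : HasDerivAt (fun w : ℝ => 2 * w + w ^ 2) 2 0 := by
    refine HasDerivAt.congr_deriv (((hasDerivAt_id _).const_mul 2).add ((hasDerivAt_id _).pow 2)) ?_
    simp
  have hl : HasDerivAt (fun w : ℝ => 3 * ((1 - 2 * p) * (1 + w) - t) * (2 * w + w ^ 2))
      (6 * (1 - 2 * p - t)) 0 := by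
    refine HasDerivAt.congr_deriv ((((hw.const_mul (1 - 2 * p)).sub_const t).const_mul 3).mul hq) ?_
    simp
    ring
  have e0 : Real.exp (2 * m * 0) = 1 := by simp
  have e1 : (1:ℝ) + 0 = 1 := add_zero 1
  have hL := (((hcube hw e1 (2 * (1 - p))).const_mul (p ^ 2)).add
    (((hcube hw e1 (1 - 2 * p)).add hl).const_mul (2 * p * (1 - p)))).add
    ((hcube hw e1 (-2 * p)).const_mul (e * (1 - p) ^ 2))
  have hR := (((hcube hr e0 (2 * (1 - p))).const_mul (p ^ 2)).add
    ((hcube hr e0 (1 - 2 * p)).const_mul (2 * p * (1 - p)))).add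
    ((hcube hr e0 (-2 * p)).const_mul (e * (1 - p) ^ 2))
  have := eventually_pos_of_hasDerivAt (hL.sub hR) (by simp) (hD.trans_eq (by ring))
  filter_upwards [this] with w hw
  simpa using hw

lemma truncCube_eq {t x : ℝ} (h : t ≤ x) : truncCube t x = (x - t) ^ 3 := by
  rw [truncCube, max_eq_left (sub_nonneg.2 h)]

lemma cube_le_truncCube (t x : ℝ) : (x - t) ^ 3 ≤ truncCube t x :=
  Odd.pow_le_pow (by decide) |>.2 (le_max_left _ _)

lemma truncCube_nonneg (t x : ℝ) : 0 ≤ truncCube t x := pow_nonneg (le_max_right _ _) 3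

/-- The two middle atoms sit at distance `|a - b| / 2` from their mean, and the square of this
distance is `(1 + w) ^ 2 - 1`. As a cube never exceeds its truncation, the atoms need not be located
relative to `t`. -/
lemma sum_cubes_le {p t a b w : ℝ} (hp0 : 0 < p) (hp1 : p < 1) (hs : a + b = 2 * (1 + w))
    (hab : a * b = 1) {e : ℝ} (he : e * (-2 * p * (1 + w) - t) ^ 3 ≤
      truncCube t (-2 * p * (1 + w))) :
    p ^ 2 * (2 * (1 - p) * (1 + w) - t) ^ 3
        + 2 * p * (1 - p) * (((1 - 2 * p) * (1 + w) - t) ^ 3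
          + 3 * ((1 - 2 * p) * (1 + w) - t) * (2 * w + w ^ 2))
        + e * (1 - p) ^ 2 * (-2 * p * (1 + w) - t) ^ 3 ≤
      twoPointAvg p a (twoPointAvg p b (truncCube t)) 0 := by
  have hq : 0 < 1 - p := by linarith
  obtain rfl : a = 2 * (1 + w) - b := by linarith
  have hb : b ^ 2 = 2 * (1 + w) * b - 1 := by linarith
  simp only [twoPointAvg]
  have k1 := mul_le_mul_of_nonneg_left (cube_le_truncCube t
    (0 + (1 - p) * (2 * (1 + w) - b) + (1 - p) * b)) (sq_nonneg p)
  have k2 := mul_le_mul_of_nonneg_left (cube_le_truncCube t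
    (0 + (1 - p) * (2 * (1 + w) - b) - p * b)) (mul_pos hp0 hq).le
  have k3 := mul_le_mul_of_nonneg_left (cube_le_truncCube t
    (0 - p * (2 * (1 + w) - b) + (1 - p) * b)) (mul_pos hp0 hq).le
  have k4 := mul_le_mul_of_nonneg_left he (sq_nonneg (1 - p))
  have e4 : 0 - p * (2 * (1 + w) - b) - p * b = -2 * p * (1 + w) := by ring
  rw [e4]
  have key : (0 + (1 - p) * (2 * (1 + w) - b) - p * b - t) ^ 3
      + (0 - p * (2 * (1 + w) - b) + (1 - p) * b - t) ^ 3 =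
      2 * (((1 - 2 * p) * (1 + w) - t) ^ 3
          + 3 * ((1 - 2 * p) * (1 + w) - t) * (2 * w + w ^ 2)) := by
    linear_combination (6 * ((1 - 2 * p) * (1 + w) - t)) * hb
  have key' := congrArg (fun z => p * (1 - p) * z) key
  simp only [mul_add] at key'
  linarith

lemma twoPointAvg_self_zero (p r : ℝ) (f : ℝ → ℝ) :
    twoPointAvg p r (twoPointAvg p r f) 0 = p ^ 2 * f (2 * (1 - p) * r)
      + 2 * p * (1 - p) * f ((1 - 2 * p) * r) + (1 - p) ^ 2 * f (-2 * p * r) := by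
  simp only [twoPointAvg]
  rw [show 0 + (1 - p) * r + (1 - p) * r = 2 * (1 - p) * r by ring,
    show 0 + (1 - p) * r - p * r = (1 - 2 * p) * r by ring,
    show 0 - p * r + (1 - p) * r = (1 - 2 * p) * r by ring,
    show 0 - p * r - p * r = -2 * p * r by ring]
  ring

/-- For an exponent below the threshold, spreading two equal scales increases the average of a
suitable truncated cube. -/
lemma exists_truncCube_violation {p m : ℝ} (hp0 : 0 < p) (hp1 : p < 1) (hm0 : 0 < m)
    (hm : m < mStar p) :
    ∃ t, ∀ᶠ w in nhdsWithin (0:ℝ) (Set.Ioi 0), ∀ a b, a + b = 2 * (1 + w) → a * b = 1 →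
      twoPointAvg p (Real.exp (2 * m * w)) (twoPointAvg p (Real.exp (2 * m * w)) (truncCube t)) 0 <
        twoPointAvg p a (twoPointAvg p b (truncCube t)) 0 := by
  have hq : 0 < 1 - p := by linarith
  have hcont : ∀ α t : ℝ, t < α →
      ∀ᶠ w in nhdsWithin (0:ℝ) (Set.Ioi 0), t < α * Real.exp (2 * m * w) := by
    intro α t h
    have hc : Continuous fun w : ℝ => α * Real.exp (2 * m * w) := by fun_prop
    exact ((hc.tendsto 0).eventually (lt_mem_nhds (by simpa using h))).filter_mono
      nhdsWithin_le_nhds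
  have hcont' : ∀ α t : ℝ, α < t →
      ∀ᶠ w in nhdsWithin (0:ℝ) (Set.Ioi 0), α * Real.exp (2 * m * w) < t := by
    intro α t h
    filter_upwards [hcont (-α) (-t) (by linarith)] with w hw
    linarith
  rcases lt_or_ge p (1 / 2) with hp | hp
  · have hg := one_lt_sqrt_div hp0 hp
    have hκ := two_mul_mStar_sub_one hp0 hp
    have hgp : √((1 - p) / p) ^ 2 * p = 1 - p := by
      rw [Real.sq_sqrt (div_pos (by linarith) hp0).le, div_mul_cancel₀ _ hp0.ne']
    generalize √((1 - p) / p) = g at *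
    have hg0 : 0 < g := by linarith
    have hz1 : g⁻¹ < 1 := inv_lt_one_of_one_lt₀ hg
    have hz0 : 0 < g⁻¹ := inv_pos.2 hg0
    -- With `t = 1 - 2 * p - z` and the lowest atom cut off, the first-order condition is `2 * m - 1
    -- < 2 * z / (p + 2 * p * z + (1 - p) * z ^ 2)`. The right side is largest at `z = 1 / g`, with
    -- value `κ`.
    refine ⟨1 - 2 * p - g⁻¹, ?_⟩
    have hD : 0 < 6 * p * (1 - p) * (2 * (1 - 2 * p - (1 - 2 * p - g⁻¹))
        - (2 * m - 1) * (p * (2 * (1 - p) - (1 - 2 * p - g⁻¹)) ^ 2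
          + (1 - 2 * p) * (1 - 2 * p - (1 - 2 * p - g⁻¹)) ^ 2
          - 0 * (1 - p) * (-2 * p - (1 - 2 * p - g⁻¹)) ^ 2)) := by
      refine mul_pos (by positivity) ?_
      have e : p * (2 * (1 - p) - (1 - 2 * p - g⁻¹)) ^ 2
          + (1 - 2 * p) * (1 - 2 * p - (1 - 2 * p - g⁻¹)) ^ 2
          - 0 * (1 - p) * (-2 * p - (1 - 2 * p - g⁻¹)) ^ 2 = 2 * p * (g⁻¹ + 1) := by
        have : g * g⁻¹ = 1 := mul_inv_cancel₀ hg0.ne'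
        linear_combination p * (g * g⁻¹ + 1) * this - g⁻¹ ^ 2 * hgp
      have hlt : 2 * m - 1 < (g ^ 2 + 1) / (g + 1) := by rw [← hκ]; linarith
      rw [lt_div_iff₀ (by linarith)] at hlt
      rw [e]
      have hp' : p = 1 / (1 + g ^ 2) := by
        rw [eq_div_iff (by positivity)]; linarith
      rw [hp', sub_sub_cancel, sub_pos]
      field_simp
      linarith
    filter_upwards [eventually_cubic_pos hD, hcont _ _ (by linarith : 1 - 2 * p - g⁻¹ < 2 * (1 - p)),
      hcont (1 - 2 * p) _ (by linarith : 1 - 2 * p - g⁻¹ < 1 - 2 * p),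
      hcont' (-2 * p) _ (by linarith : -2 * p < 1 - 2 * p - g⁻¹)]
      with w h1 h2 h3 h4 a b hs hab
    refine lt_of_eq_of_lt ?_ (h1.trans_le (sum_cubes_le hp0 hp1 hs hab ?_))
    · rw [twoPointAvg_self_zero, truncCube_eq h2.le, truncCube_eq h3.le, truncCube,
        max_eq_right (sub_nonpos.2 h4.le)]
      ring
    · rw [zero_mul]
      exact truncCube_nonneg _ _
  · rw [mStar_of_half_le hp] at hm
    obtain ⟨κ, rfl⟩ : ∃ κ, m = (κ + 1) / 2 := ⟨2 * m - 1, by ring⟩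
    have hκ : 0 < 1 - κ := by linarith
    -- No atom is truncated here, and the condition becomes `2 * z * (1 - κ) > κ * (2 * p - 1)`,
    -- which holds for large `z` since `κ < 1`.
    obtain ⟨z, hz⟩ : ∃ z, z = 2 + |κ| / (1 - κ) := ⟨_, rfl⟩
    have hz2 : 2 ≤ z := by
      rw [hz]
      have : 0 ≤ |κ| / (1 - κ) := by positivity
      linarith
    have hzκ : z * (1 - κ) = 2 * (1 - κ) + |κ| := by
      rw [hz, add_mul, div_mul_cancel₀ _ hκ.ne']
    have hbound : κ * (2 * p - 1) ≤ |κ| := by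
      refine (le_abs_self _).trans ?_
      rw [abs_mul]
      exact mul_le_of_le_one_right (abs_nonneg _) (abs_le.2 ⟨by linarith, by linarith⟩)
    refine ⟨1 - 2 * p - z, ?_⟩
    have hD : 0 < 6 * p * (1 - p) * (2 * (1 - 2 * p - (1 - 2 * p - z))
        - (2 * ((κ + 1) / 2) - 1) * (p * (2 * (1 - p) - (1 - 2 * p - z)) ^ 2
          + (1 - 2 * p) * (1 - 2 * p - (1 - 2 * p - z)) ^ 2
          - 1 * (1 - p) * (-2 * p - (1 - 2 * p - z)) ^ 2)) := by
      refine mul_pos (by positivity) ?_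
      have : 0 ≤ |κ| := abs_nonneg κ
      linarith
    filter_upwards [eventually_cubic_pos hD, hcont _ _ (by linarith : 1 - 2 * p - z < 2 * (1 - p)),
      hcont (1 - 2 * p) _ (by linarith : 1 - 2 * p - z < 1 - 2 * p),
      hcont (-2 * p) _ (by linarith : 1 - 2 * p - z < -2 * p)]
      with w h1 h2 h3 h4 a b hs hab
    refine lt_of_eq_of_lt ?_ (h1.trans_le (sum_cubes_le hp0 hp1 hs hab ?_))
    · rw [twoPointAvg_self_zero, truncCube_eq h2.le, truncCube_eq h3.le, truncCube_eq h4.le]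
      ring
    · rw [one_mul]
      exact cube_le_truncCube _ _

/-! ### The two-step martingale realizing the violation. -/

lemma ae_stdBernoulli_mem {p : ℝ} (hp0 : 0 < p) (hp1 : p < 1) :
    ∀ᵐ x ∂stdBernoulli p, -(p * invSd p) ≤ x ∧ x ≤ (1 - p) * invSd p := by
  have hk := invSd_pos hp0 hp1
  have h1 := mul_pos hp0 hk
  have h2 := mul_pos (by linarith : 0 < 1 - p) hk
  rw [stdBernoulli_eq hp0 hp1, ae_add_measure_iff]
  refine ⟨Measure.ae_smul_measure ?_ _, Measure.ae_smul_measure ?_ _⟩ <;>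
  · rw [ae_dirac_eq, Filter.eventually_pure]
    constructor <;> linarith

section Law
variable {p : ℝ} {Ω : Type*} [MeasurableSpace Ω] {P : Measure Ω} {X : Ω → ℝ}

lemma ProbabilityTheory.HasLaw.ae_mem_of_stdBernoulli (hp0 : 0 < p) (hp1 : p < 1) (hX : HasLaw X (stdBernoulli p) P) :
    ∀ᵐ ω ∂P, -(p * invSd p) ≤ X ω ∧ X ω ≤ (1 - p) * invSd p :=
  ae_of_ae_map hX.aemeasurable (by rw [hX.map_eq]; exact ae_stdBernoulli_mem hp0 hp1)

lemma ProbabilityTheory.HasLaw.integrable_of_stdBernoulli [IsFiniteMeasure P] (hp0 : 0 < p) (hp1 : p < 1)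
    (hX : HasLaw X (stdBernoulli p) P) : Integrable X P := by
  have h := hX.ae_mem_of_stdBernoulli hp0 hp1
  exact integrable_of_le_of_le hX.aemeasurable.aestronglyMeasurable (h.mono fun ω h => h.1)
    (h.mono fun ω h => h.2) (integrable_const _) (integrable_const _)

lemma ProbabilityTheory.HasLaw.integral_eq_zero_of_stdBernoulli (hp0 : 0 < p) (hp1 : p < 1)
    (hX : HasLaw X (stdBernoulli p) P) : ∫ ω, X ω ∂P = 0 := by
  have h := integral_map (μ := P) hX.aemeasurable (f := fun x : ℝ => x)
    measurable_id.aestronglyMeasurable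
  rw [← h, hX.map_eq, stdBernoulli_eq hp0 hp1, integral_add_measure, integral_smul_measure,
    integral_smul_measure, integral_dirac, integral_dirac, ENNReal.toReal_ofReal hp0.le,
    ENNReal.toReal_ofReal (by linarith)]
  · simp only [smul_eq_mul]; ring
  · exact (integrable_dirac enorm_lt_top).smul_measure ENNReal.ofReal_ne_top
  · exact (integrable_dirac enorm_lt_top).smul_measure ENNReal.ofReal_ne_top

end Law

/-- The two-step process with increments `c 0 * BS 0` and `c 1 * BS 1`. -/
def twoStep {Ω : Type*} (c : Fin 2 → ℝ) (BS : Fin 2 → Ω → ℝ) : ℕ → Ω → ℝ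
  | 0 => 0
  | 1 => fun ω => c 0 * BS 0 ω
  | _ + 2 => fun ω => c 0 * BS 0 ω + c 1 * BS 1 ω

/-- The filtration that is trivial at time `0`, generated by `X` at time `1`, and full
afterwards. -/
def twoStepFiltration {Ω : Type*} [mΩ : MeasurableSpace Ω] {X : Ω → ℝ} (hX : Measurable X) :
    Filtration ℕ mΩ where
  seq
    | 0 => ⊥
    | 1 => MeasurableSpace.comap X inferInstance
    | _ + 2 => mΩ
  mono' := by
    refine monotone_nat_of_le_succ fun n => ?_
    match n with
    | 0 => exact bot_le
    | 1 => exact hX.comap_le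
    | _ + 2 => exact le_rfl
  le' := by
    intro n
    match n with
    | 0 => exact bot_le
    | 1 => exact hX.comap_le
    | _ + 2 => exact le_rfl

lemma isBoundedAsymmetrySupermartingale_twoStep {p : ℝ} (hp0 : 0 < p) (hp1 : p < 1) {Ω : Type*}
    [MeasurableSpace Ω] {P : Measure Ω} [IsProbabilityMeasure P] {BS : Fin 2 → Ω → ℝ}
    (hBS : IsIIDStdBernoulli P p BS) (hm : ∀ i, Measurable (BS i)) {c : Fin 2 → ℝ}
    (hc : ∀ i, 0 < c i) :
    IsBoundedAsymmetrySupermartingale P (twoStepFiltration (hm 0)) p 2 (twoStep c BS)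
      (fun i _ => c (Fin.ofNat 2 i) * (p * invSd p))
      (fun i _ => c (Fin.ofNat 2 i) * ((1 - p) * invSd p)) c := by
  have hk := invSd_pos hp0 hp1
  have hq : 0 < 1 - p := by linarith
  have hi := fun i => (hBS.law i).integrable_of_stdBernoulli hp0 hp1
  have hz := fun i => (hBS.law i).integral_eq_zero_of_stdBernoulli hp0 hp1
  have hint : ∀ k, Integrable (twoStep c BS k) P := by
    intro k
    match k with
    | 0 => exact integrable_zero _ _ _
    | 1 => exact (hi 0).const_mul _
    | _ + 2 => exact ((hi 0).const_mul _).add ((hi 1).const_mul _)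
  have hsm : StronglyMeasurable[MeasurableSpace.comap (BS 0) inferInstance] fun ω => c 0 * BS 0 ω :=
    ((comap_measurable (BS 0)).const_mul (c 0)).stronglyMeasurable
  have hadp : StronglyAdapted (twoStepFiltration (hm 0)) (twoStep c BS) := by
    intro k
    match k with
    | 0 => exact stronglyMeasurable_zero
    | 1 => exact hsm
    | _ + 2 =>
      exact (((hm 0).const_mul (c 0)).add ((hm 1).const_mul (c 1))).stronglyMeasurable
  have hdiff : ∀ i : Fin 2, ∀ ω, twoStep c BS (i + 1) ω - twoStep c BS i ω = c i * BS i ω := by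
    intro i ω
    fin_cases i <;> simp [twoStep]
  have hof : ∀ i : Fin 2, Fin.ofNat 2 (i : ℕ) = i := by decide
  refine ⟨supermartingale_nat hadp hint fun k => ?_, .of_forall fun ω => le_rfl,
    fun i => measurable_const, fun i => measurable_const, fun i => .of_forall fun ω => ?_,
    fun i => .of_forall fun ω => ?_, fun i => ?_, fun i => ?_, fun i => .of_forall fun ω => ?_,
    fun i => .of_forall fun ω => ?_⟩
  · match k with
    | 0 =>
      have e : P[twoStep c BS 1 | (⊥ : MeasurableSpace Ω)] = fun _ => 0 := by
        rw [condExp_bot]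
        funext _
        simp only [twoStep, integral_const_mul, hz, mul_zero]
      exact (Filter.EventuallyEq.of_eq e).le
    | 1 =>
      have h1 := condExp_add (hint 1) ((hi 1).const_mul (c 1))
        (MeasurableSpace.comap (BS 0) inferInstance)
      rw [condExp_of_stronglyMeasurable (f := twoStep c BS 1) (hm 0).comap_le hsm (hint 1)] at h1
      have hind : Indep (MeasurableSpace.comap (BS 1) inferInstance)
          (MeasurableSpace.comap (BS 0) inferInstance) P :=
        (hBS.indep.indepFun (by decide : (1 : Fin 2) ≠ 0))
      have h2 := condExp_indep_eq (hm 1).comap_le (hm 0).comap_le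
        ((comap_measurable (BS 1)).const_mul (c 1)).stronglyMeasurable hind
      refine Filter.EventuallyLE.trans (Filter.EventuallyEq.le h1) ?_
      filter_upwards [h2] with ω h
      rw [Pi.add_apply, h, integral_const_mul, hz, mul_zero, add_zero]
    | k + 2 =>
      exact (Filter.EventuallyEq.of_eq (condExp_of_stronglyMeasurable
        ((twoStepFiltration (hm 0)).le (k + 2)) (hadp (k + 2)) (hint (k + 2)))).le
  · have := hc i
    simp only [hof]
    positivity
  · have := hc i
    simp only [hof]
    positivity
  · filter_upwards [(hBS.law i).ae_mem_of_stdBernoulli hp0 hp1] with ω h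
    rw [hdiff, hof, ← mul_neg]
    exact mul_le_mul_of_nonneg_left h.1 (hc i).le
  · filter_upwards [(hBS.law i).ae_mem_of_stdBernoulli hp0 hp1] with ω h
    rw [hdiff, hof]
    exact mul_le_mul_of_nonneg_left h.2 (hc i).le
  · rw [hof, Real.sqrt_le_left (hc i).le]
    refine le_of_eq ?_
    linear_combination c i ^ 2 * mul_invSd_sq hp0 hp1
  · rw [hof, mul_div_mul_left _ _ (hc i).ne', mul_div_mul_right _ _ hk.ne']

lemma isIIDStdBernoulli_pi {p : ℝ} (hp0 : 0 < p) (hp1 : p < 1) (n : ℕ) :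
    IsIIDStdBernoulli (Measure.pi fun _ : Fin n => stdBernoulli p) p fun i ω => ω i := by
  have := isProbabilityMeasure_stdBernoulli hp0 hp1
  refine ⟨fun i => ⟨(measurable_pi_apply i).aemeasurable, ?_⟩, ?_⟩
  · exact (measurePreserving_eval (fun _ : Fin n => stdBernoulli p) i).map_eq
  · exact iIndepFun_pi (X := fun _ x => x) fun i => aemeasurable_id

/-- The normalized power mean is `cosh (2 * m * δ) ^ (1 / (2 * m)) ≤ exp (m * δ ^ 2)`, and `δ ^ 2 /
2 ≤ cosh δ - 1`. Nothing is lost to first order in `cosh δ - 1`. -/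
lemma powerMean_exp_le {p m δ : ℝ} (hp0 : 0 < p) (hp1 : p < 1) (hm : 0 < m) :
    0 < powerMean m ![Real.exp (-δ) / invSd p, Real.exp δ / invSd p] ∧
    invSd p * powerMean m ![Real.exp (-δ) / invSd p, Real.exp δ / invSd p] ≤
      Real.exp (2 * m * (Real.cosh δ - 1)) := by
  have hk := invSd_pos hp0 hp1
  have hinv : 2 * m * (1 / (2 * m)) = 1 := by field_simp
  have e : powerMean m ![Real.exp (-δ) / invSd p, Real.exp δ / invSd p] =
      Real.cosh (2 * m * δ) ^ (1 / (2 * m)) / invSd p := by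
    have e1 : (1 / ((2 : ℕ) : ℝ)) * ∑ i, ![Real.exp (-δ) / invSd p, Real.exp δ / invSd p] i ^ (2 * m)
        = Real.cosh (2 * m * δ) / invSd p ^ (2 * m) := by
      simp only [Fin.sum_univ_two, Matrix.cons_val_zero, Matrix.cons_val_one]
      rw [Real.div_rpow (Real.exp_pos _).le hk.le, Real.div_rpow (Real.exp_pos _).le hk.le,
        ← Real.exp_mul, ← Real.exp_mul, Real.cosh_eq]
      push_cast
      ring_nf
    rw [powerMean, e1, Real.div_rpow (Real.cosh_pos _).le (Real.rpow_nonneg hk.le _),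
      ← Real.rpow_mul hk.le, hinv, Real.rpow_one]
  rw [e, mul_div_cancel₀ _ hk.ne']
  refine ⟨div_pos (Real.rpow_pos_of_pos (Real.cosh_pos _) _) hk, ?_⟩
  have h1 : Real.cosh (2 * m * δ) ^ (1 / (2 * m)) ≤
      Real.exp ((2 * m * δ) ^ 2 / 2) ^ (1 / (2 * m)) :=
    Real.rpow_le_rpow (Real.cosh_pos _).le (Real.cosh_le_exp_half_sq _) (by positivity)
  refine h1.trans ?_
  rw [← Real.exp_mul, Real.exp_le_exp]
  have e3 : (2 * m * δ) ^ 2 / 2 * (1 / (2 * m)) = 2 * m * (δ ^ 2 / 2) := by field_simp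
  rw [e3]
  refine mul_le_mul_of_nonneg_left ?_ (by positivity)
  have h2 : (δ / 2) ^ 2 ≤ Real.sinh (δ / 2) ^ 2 := by
    rw [sq_le_sq, Real.abs_sinh]
    exact Real.self_le_sinh_iff.2 (abs_nonneg _)
  have h3 : Real.cosh δ = Real.cosh (δ / 2) ^ 2 + Real.sinh (δ / 2) ^ 2 := by
    rw [← Real.cosh_two_mul, mul_div_cancel₀ _ two_ne_zero]
  have h4 := Real.cosh_sq (δ / 2)
  linarith

/-- Exactness of the threshold. -/
theorem exactness {p m : ℝ} (hp0 : 0 < p) (hp1 : p < 1) (hm0 : 0 < m) (hm : m < mStar p) :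
    ∃ c : Fin 2 → ℝ, (∀ i, 0 < c i) ∧ ∃ f ∈ classF3, ∀ (Ω : Type) (_ : MeasurableSpace Ω)
      (P : Measure Ω) (_ : IsProbabilityMeasure P) (BS : Fin 2 → Ω → ℝ),
      IsIIDStdBernoulli P p BS →
        Integrable (fun ω => f (twoStep c BS 2 ω)) P ∧
        Integrable (fun ω => f (powerMean m c * ∑ i, BS i ω)) P ∧
        ∫ ω, f (powerMean m c * ∑ i, BS i ω) ∂P < ∫ ω, f (twoStep c BS 2 ω) ∂P := by
  obtain ⟨t, ht⟩ := exists_truncCube_violation hp0 hp1 hm0 hm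
  obtain ⟨w, hw, hw0⟩ := (ht.and self_mem_nhdsWithin).exists
  have hw0 : 0 < w := hw0
  have hk := invSd_pos hp0 hp1
  -- Then `e^(-δ)` and `e^δ` have sum `2 * (1 + w)` and product `1`; dividing by `invSd p` makes
  -- them the normalized scales.
  obtain ⟨δ, hδ⟩ : ∃ δ, Real.cosh δ = 1 + w :=
    ⟨Real.arcosh (1 + w), Real.cosh_arcosh (by linarith)⟩
  set c : Fin 2 → ℝ := ![Real.exp (-δ) / invSd p, Real.exp δ / invSd p] with hc
  obtain ⟨hs0, hs⟩ := powerMean_exp_le (δ := δ) hp0 hp1 hm0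
  rw [← hc] at hs0 hs
  rw [hδ, add_sub_cancel_left] at hs
  obtain ⟨f1, f2, hf⟩ := exists_isF3_of_mem_classF3 (truncCube_mem_classF3 t)
  refine ⟨c, fun i => ?_, truncCube t, truncCube_mem_classF3 t, fun Ω _ P _ BS hBS => ?_⟩
  · fin_cases i <;> exact div_pos (Real.exp_pos _) hk
  obtain ⟨h1, h2⟩ := integral_weighted_sum hp0 hp1 hBS c hf.continuous 0
  obtain ⟨h3, h4⟩ := integral_weighted_sum hp0 hp1 hBS (fun _ => powerMean m c) hf.continuous 0
  simp only [zero_add, ← Finset.mul_sum] at h3 h4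
  simp only [zero_add, Fin.sum_univ_two] at h1 h2
  refine ⟨h1, h3, ?_⟩
  have hlt := hw (Real.exp (-δ)) (Real.exp δ) (by rw [← hδ, Real.cosh_eq]; ring)
    (by rw [← Real.exp_add, neg_add_cancel, Real.exp_zero])
  have e1 : invSd p * c 0 = Real.exp (-δ) := by simp [hc]; field_simp
  have e2 : invSd p * c 1 = Real.exp δ := by simp [hc]; field_simp
  have hpos := mul_pos hk hs0
  calc ∫ ω, truncCube t (powerMean m c * ∑ i, BS i ω) ∂P
      = twoPointAvg p (invSd p * powerMean m c)
          (twoPointAvg p (invSd p * powerMean m c) (truncCube t)) 0 := by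
        rw [h4]; simp [List.ofFn_succ]
    _ ≤ twoPointAvg p (Real.exp (2 * m * w))
          (twoPointAvg p (Real.exp (2 * m * w)) (truncCube t)) 0 :=
        (twoPointAvg_mono hp0 hp1 _ (fun x => hf.twoPointAvg_mono_scale hp0 hp1 hpos hs x) 0).trans
          ((hf.avg hp0 hp1 _).twoPointAvg_mono_scale hp0 hp1 hpos hs 0)
    _ < twoPointAvg p (Real.exp (-δ)) (twoPointAvg p (Real.exp δ) (truncCube t)) 0 := hlt
    _ = ∫ ω, truncCube t (twoStep c BS 2 ω) ∂P := by
        simp only [twoStep]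
        rw [h2]
        simp [List.ofFn_succ, e1, e2]

theorem mainTheorem4 (p : ℝ) (hp0 : 0 < p) (hp1 : p < 1) :
    -- the comparison inequality, for every `m ≥ m_*(p)`
    (∀ m : ℝ, mStar p ≤ m →
      ∀ (n : ℕ), 1 ≤ n →
      ∀ (Ω : Type*) (mΩ : MeasurableSpace Ω) (μ : Measure Ω) (_ : IsProbabilityMeasure μ)
        (ℱ : Filtration ℕ mΩ) (S A B : ℕ → Ω → ℝ) (c : Fin n → ℝ),
        IsBoundedAsymmetrySupermartingale μ ℱ p n S A B c →
      ∀ (Ω' : Type*) (_ : MeasurableSpace Ω') (P : Measure Ω') (_ : IsProbabilityMeasure P)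
        (BS : Fin n → Ω' → ℝ), IsIIDStdBernoulli P p BS →
      ∀ f ∈ classF3,
        Integrable (fun ω => f (S n ω)) μ ∧
        Integrable (fun ω' => f (powerMean m c * ∑ i, BS i ω')) P ∧
        ∫ ω, f (S n ω) ∂μ ≤ ∫ ω', f (powerMean m c * ∑ i, BS i ω') ∂P) ∧
    -- exactness: for every positive `m < m_*(p)` the inequality fails in some instance
    (∀ m : ℝ, 0 < m → m < mStar p →
      ∃ (n : ℕ), 1 ≤ n ∧
      ∃ (Ω : Type) (mΩ : MeasurableSpace Ω) (μ : Measure Ω) (_ : IsProbabilityMeasure μ)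
        (ℱ : Filtration ℕ mΩ) (S A B : ℕ → Ω → ℝ) (c : Fin n → ℝ),
        IsBoundedAsymmetrySupermartingale μ ℱ p n S A B c ∧
      ∃ (Ω' : Type) (_ : MeasurableSpace Ω') (P : Measure Ω') (_ : IsProbabilityMeasure P)
        (BS : Fin n → Ω' → ℝ), IsIIDStdBernoulli P p BS ∧
      ∃ f ∈ classF3,
        Integrable (fun ω => f (S n ω)) μ ∧
        Integrable (fun ω' => f (powerMean m c * ∑ i, BS i ω')) P ∧
        ∫ ω', f (powerMean m c * ∑ i, BS i ω') ∂P < ∫ ω, f (S n ω) ∂μ) := by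
  refine ⟨fun m hm n hn Ω mΩ μ _ ℱ S A B c h Ω' _ P _ BS hBS f hf =>
    comparison_inequality hp0 hp1 hm hn h hBS hf, fun m hm0 hm => ?_⟩
  obtain ⟨c, hc, f, hf, h⟩ := exactness hp0 hp1 hm0 hm
  have := isProbabilityMeasure_stdBernoulli hp0 hp1
  have hBS := isIIDStdBernoulli_pi hp0 hp1 2
  obtain ⟨h1, h2, h3⟩ := h _ _ _ inferInstance _ hBS
  exact ⟨2, by norm_num, _, _, _, inferInstance, _, _, _, _, c,
    isBoundedAsymmetrySupermartingale_twoStep hp0 hp1 hBS (fun i => measurable_pi_apply i) hc,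
    _, _, _, inferInstance, _, hBS, f, hf, h1, h2, h3⟩
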